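/- All normed spaces are over $\mathbf{R}$. A \emph{Gurarij space} is a separable Banach space $\mathbf{G}$ such that for every $\varepsilon>0$, all finite-dimensional normed spaces $E\subseteq F$ and every linear isometric embedding $\psi\colon E\to\mathbf{G}$ there is an injective linear map $\varphi\colon F\to\mathbf{G}$ extending $\psi$ with $(1-\varepsilon)\|x\|\le\|\varphi x\|\le(1+\varepsilon)\|x\|$ for all $x\in F$. For a metric space $X$ let $\mathrm{Iso}(X)$ be the group of isometries of $X$ onto itself, and for a normed space $E$ let $\mathrm{Iso}_L(E)$ be the group of linear isometries of $E$ onto itself, both with the topology of pointwise convergence. An isometric embedding $\iota\colon X\to Y$ of metric spaces is a \emph{$g$-embedding} if there is a continuous group homomorphism $\Theta\colon\mathrm{Iso}(X)\to\mathrm{Iso}(Y)$ such that $\Theta(\varphi)\circ\iota=\iota\circ\varphi$ for all $\varphi\in\mathrm{Iso}(X)$. \textbf{Theorem.} A Gurarij space exists. If $\mathbf{G}$ is any Gurarij space, then $\mathrm{Iso}_L(\mathbf{G})$ is a universal Polish group: it is a Polish topological group, and for every Polish group $H$ there is a group homomorphism $H\to\mathrm{Iso}_L(\mathbf{G})$ that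 is a homeomorphism onto its image. Moreover, every separable normed space $E$ (not necessarily complete) is $g$-embeddable in $\mathbf{G}$: there is a linear isometric embedding $E\to\mathbf{G}$ that is a $g$-embedding. -/

import Mathlib

open Topology

universe u v w

/-- The group `Iso(X)` of surjective isometries `X ≃ᵢ X` of a metric space,
with the topology of pointwise convergence. -/
instance IsometryEquiv.pointwiseTopology {X : Type u} [MetricSpace X] :
    TopologicalSpace (X ≃ᵢ X) :=
  TopologicalSpace.induced (fun (φ : X ≃ᵢ X) (x : X) => φ x) inferInstance

/-- The group `Iso_L(E)` of surjective linear isometries `E ≃ₗᵢ[ℝ] E` of a real normed space,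
with the topology of pointwise convergence. -/
instance LinearIsometryEquiv.pointwiseTopology {E : Type u} [NormedAddCommGroup E]
    [NormedSpace ℝ E] : TopologicalSpace (E ≃ₗᵢ[ℝ] E) :=
  TopologicalSpace.induced (fun (φ : E ≃ₗᵢ[ℝ] E) (x : E) => φ x) inferInstance

/-- A Gurarij space: a separable real Banach space `G` such that for every `ε > 0`, all
finite-dimensional normed spaces `E ⊆ F` and every linear isometric embedding `ψ : E → G` there is
an injective linear map `φ : F → G` which extends `ψ` and is `ε`-isometric.
(Every finite-dimensional normed space is isometric to one whose carrier lives in `Type`, so that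
it is enough to quantify over those.) -/
structure IsGurarij (G : Type u) [NormedAddCommGroup G] [NormedSpace ℝ G] : Prop where
  complete : CompleteSpace G
  separable : TopologicalSpace.SeparableSpace G
  extension : ∀ ε : ℝ, 0 < ε →
    ∀ (F : Type) [NormedAddCommGroup F] [NormedSpace ℝ F] [FiniteDimensional ℝ F]
      (E : Submodule ℝ F) (ψ : E →ₗᵢ[ℝ] G),
      ∃ φ : F →ₗ[ℝ] G, Function.Injective φ ∧ (∀ x : E, φ (x : F) = ψ x) ∧
        ∀ x : F, (1 - ε) * ‖x‖ ≤ ‖φ x‖ ∧ ‖φ x‖ ≤ (1 + ε) * ‖x‖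

/-- A universal Polish group: a Polish topological group `U` such that every Polish group embeds in
`U` by a group homomorphism that is a homeomorphism onto its image. -/
structure IsUniversalPolishGroup (U : Type u) [Group U] [TopologicalSpace U] : Prop where
  isTopologicalGroup : IsTopologicalGroup U
  polish : PolishSpace U
  universal : ∀ (H : Type w) [Group H] [TopologicalSpace H] [IsTopologicalGroup H] [PolishSpace H],
    ∃ f : H →* U, IsEmbedding f

/-- A map `ι : X → Y` of metric spaces is a `g`-embedding if it is isometric and there is a
continuous group homomorphism `Θ : Iso(X) → Iso(Y)` such that `Θ φ` extends `φ`
(along `ι`) for every `φ ∈ Iso(X)`. -/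
def IsGEmbedding {X : Type u} {Y : Type v} [MetricSpace X] [MetricSpace Y] (ι : X → Y) : Prop :=
  Isometry ι ∧ ∃ Θ : (X ≃ᵢ X) →* (Y ≃ᵢ Y), Continuous Θ ∧
    ∀ (φ : X ≃ᵢ X) (x : X), Θ φ (ι x) = ι (φ x)

/-!
# The linear isometry group of the Gurarij space is a universal Polish group

**An equivariant Gurarij extension.** For a normed space `X` let `B` be the unit ball of its dual
with the weak-* topology. Then `X` embeds isometrically in `C(B × [0, 1])` as the space of evaluations,
and an action on `X` by linear isometries carries over. If `E ⊆ X` is finite-dimensional and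
`E ⊆ E + ℝ v` is an extension of normed spaces, then the values at `v` of the norm-one extensions of
`l ∈ B` from `E` to `E + ℝ v` form an interval. The function whose value at `(l, s)` is the convex
combination, with parameter `s`, of the end points of this interval realises the vector `v`, by the
Hahn–Banach theorem. The end points need not depend continuously on `l`; they do after a small
change, which costs an arbitrarily small error (`exists_dualBallMaps_realising`). Iterating the
construction and passing to the completed union gives, for every separable `E`, a Gurarij space
that contains `E` and to which all linear isometries of `E` extend, continuously and compatibly with
composition (`ActedSpace.exists_gurarij`). In particular a Gurarij space exists.

**Uniqueness.** Any two Gurarij spaces are linearly isometric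
(`IsGurarij.nonempty_linearIsometryEquiv`), by a back-and-forth argument. Its main step is
`IsGurarij.exists_tuple_near`: if two tuples have almost the same type, meaning that the norms of
corresponding linear combinations agree up to `δ` times the `ℓ¹`-norm of the coefficients, then their
spans have an amalgam in which the tuples are `δ`-close. The norm of the amalgam is an infimal
convolution of seminorms. So the extension above may be taken inside any given Gurarij space.

**Groups.** A Polish group `H` has a bounded compatible length function, by the Birkhoff–Kakutani
argument; its translates span a separable subspace `E` of the bounded continuous functions on `H`, and
`H` embeds in the linear isometry group of `E`, hence in that of the Gurarij space. The latter group
is Polish because evaluating an isometry and its inverse along a dense sequence is a closed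
embedding. By the Mazur–Ulam theorem every isometry of `E` is a linear isometry followed by a
translation, so extending linear isometries is enough to obtain a `g`-embedding.
-/

/-! ### Seminorms: infimal convolution and the Hahn–Banach theorem -/

section SeminormTools

variable {V : Type u} {W : Type v} [AddCommGroup V] [Module ℝ V] [AddCommGroup W] [Module ℝ W]

theorem Seminorm.bddBelow_range_infConv (p : Seminorm ℝ V) (j : W →ₗ[ℝ] V) (q : Seminorm ℝ W)
    (z : V) : BddBelow (Set.range fun w => q w + p (z - j w)) :=
  ⟨0, by rintro _ ⟨w, rfl⟩; dsimp only; positivity⟩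

/-- The infimal convolution of a seminorm `p` on `V` and a seminorm `q` on `W` along a linear map
`j : W → V`. It is the largest seminorm `N` on `V` with `N ≤ p` and `N ∘ j ≤ q`. -/
noncomputable def Seminorm.infConv (p : Seminorm ℝ V) (j : W →ₗ[ℝ] V) (q : Seminorm ℝ W) :
    Seminorm ℝ V :=
  Seminorm.of (fun z => ⨅ w, q w + p (z - j w))
    (fun x y => by
      refine le_ciInf_add_ciInf fun u w => ?_
      refine (ciInf_le (p.bddBelow_range_infConv j q (x + y)) (u + w)).trans ?_
      have h1 := map_add_le_add q u w
      have h2 := map_add_le_add p (x - j u) (y - j w)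
      have h3 : x + y - j (u + w) = x - j u + (y - j w) := by rw [map_add]; abel
      rw [h3]; linarith)
    (fun a x => by
      obtain rfl | ha := eq_or_ne a 0
      · rw [norm_zero, zero_mul, zero_smul]
        refine le_antisymm ?_ (le_ciInf fun w => by positivity)
        refine (ciInf_le (p.bddBelow_range_infConv j q 0) 0).trans ?_
        simp
      · rw [Real.mul_iInf_of_nonneg (norm_nonneg a)]
        refine Function.Surjective.iInf_congr ((a⁻¹ • ·) : W → W)
          (fun w => ⟨a • w, inv_smul_smul₀ ha w⟩) fun w => ?_
        rw [mul_add, ← map_smul_eq_mul q, ← map_smul_eq_mul p, smul_sub, ← j.map_smul,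
          smul_inv_smul₀ ha])

theorem Seminorm.infConv_le (p : Seminorm ℝ V) (j : W →ₗ[ℝ] V) (q : Seminorm ℝ W) (z : V) (w : W) :
    p.infConv j q z ≤ q w + p (z - j w) :=
  ciInf_le (p.bddBelow_range_infConv j q z) w

theorem Seminorm.le_infConv {p : Seminorm ℝ V} {j : W →ₗ[ℝ] V} {q : Seminorm ℝ W} {z : V} {r : ℝ}
    (h : ∀ w, r ≤ q w + p (z - j w)) : r ≤ p.infConv j q z :=
  le_ciInf h

theorem Seminorm.infConv_le_left (p : Seminorm ℝ V) (j : W →ₗ[ℝ] V) (q : Seminorm ℝ W) (z : V) :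
    p.infConv j q z ≤ p z := by
  simpa using p.infConv_le j q z 0

theorem Seminorm.infConv_apply_le (p : Seminorm ℝ V) (j : W →ₗ[ℝ] V) (q : Seminorm ℝ W) (w : W) :
    p.infConv j q (j w) ≤ q w := by
  simpa using p.infConv_le j q (j w) w

/-- Hahn–Banach for a functional given on the domain of a linear map `T` and dominated by the
pullback of a seminorm along `T`. -/
theorem LinearMap.exists_dual_comp_eq (T : W →ₗ[ℝ] V) (p : Seminorm ℝ V) (μ : W →ₗ[ℝ] ℝ)
    (h : ∀ w, |μ w| ≤ p (T w)) : ∃ f : V →ₗ[ℝ] ℝ, (∀ w, f (T w) = μ w) ∧ ∀ x, |f x| ≤ p x := by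
  obtain ⟨s, hs⟩ := T.rangeRestrict.exists_rightInverse_of_surjective
    (LinearMap.range_eq_top.2 T.surjective_rangeRestrict)
  have hs' : ∀ y, T (s y) = y := fun y => congrArg Subtype.val (LinearMap.congr_fun hs y)
  obtain ⟨f, hf, hfp⟩ := Module.Dual.exists_extension_of_le_seminorm_real
    (LinearMap.range T) (μ ∘ₗ s) (p := p) (fun y => by
      have := (le_abs_self _).trans (h (s y))
      rwa [hs'] at this)
  refine ⟨f, fun w => ?_, hfp⟩
  have h1 : f (T w) = μ (s ⟨T w, LinearMap.mem_range_self T w⟩) :=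
    hf ⟨T w, LinearMap.mem_range_self T w⟩
  have h2 := h (s ⟨T w, LinearMap.mem_range_self T w⟩ - w)
  rw [map_sub T, hs', sub_self, map_zero, abs_nonpos_iff, map_sub, sub_eq_zero] at h2
  rw [h1, h2]

theorem Seminorm.exists_dual_apply_eq (p : Seminorm ℝ V) (z : V) :
    ∃ f : V →ₗ[ℝ] ℝ, f z = p z ∧ ∀ x, |f x| ≤ p x := by
  obtain ⟨f, hf, hfp⟩ := (LinearMap.toSpanSingleton ℝ V z).exists_dual_comp_eq p
    (LinearMap.toSpanSingleton ℝ ℝ (p z)) (fun t => by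
      simp [map_smul_eq_mul, abs_mul, abs_of_nonneg (apply_nonneg p z)])
  exact ⟨f, by simpa using hf 1, hfp⟩

end SeminormTools

/-! ### Uniqueness of the Gurarij space -/

section ApproximateExtension

/-- The extension property of a Gurarij space for seminorms in place of norms. -/
theorem IsGurarij.exists_extension_seminorm {G : Type u} [NormedAddCommGroup G] [NormedSpace ℝ G]
    (hG : IsGurarij G) {V : Type} [AddCommGroup V] [Module ℝ V] [FiniteDimensional ℝ V]
    {W : Type v} [AddCommGroup W] [Module ℝ W] (N : Seminorm ℝ V) (i : W →ₗ[ℝ] V) (A : W →ₗ[ℝ] G)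
    (hA : ∀ w, ‖A w‖ = N (i w)) {ε : ℝ} (hε : 0 < ε) :
    ∃ φ : V →ₗ[ℝ] G, (∀ w, φ (i w) = A w) ∧ ∀ z, |‖φ z‖ - N z| ≤ ε * N z := by
  let : SeminormedAddCommGroup V := N.toAddGroupSeminorm.toSeminormedAddCommGroup
  have hN : ∀ z : V, ‖z‖ = N z := fun _ => rfl
  let : NormedSpace ℝ V := ⟨fun a x => by rw [hN, hN, map_smul_eq_mul]⟩
  let mk : V →ₗ[ℝ] SeparationQuotient V := (SeparationQuotient.mkCLM ℝ V).toLinearMap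
  have hmk : ∀ z : V, ‖mk z‖ = N z := fun z => SeparationQuotient.norm_mk z
  have : FiniteDimensional ℝ (SeparationQuotient V) :=
    Module.Finite.of_surjective mk SeparationQuotient.surjective_mk
  obtain ⟨s, hs⟩ := (mk ∘ₗ i).rangeRestrict.exists_rightInverse_of_surjective
    (LinearMap.range_eq_top.2 (mk ∘ₗ i).surjective_rangeRestrict)
  have hs' : ∀ y, mk (i (s y)) = y := fun y => congrArg Subtype.val (LinearMap.congr_fun hs y)
  let ψ : LinearMap.range (mk ∘ₗ i) →ₗᵢ[ℝ] G :=
    { toLinearMap := A ∘ₗ s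
      norm_map' := fun y => by
        change ‖A (s y)‖ = ‖(y : SeparationQuotient V)‖
        rw [hA, ← hmk, hs'] }
  obtain ⟨φ, -, h1, h2⟩ := hG.extension ε hε (SeparationQuotient V) _ ψ
  refine ⟨φ ∘ₗ mk, fun w => ?_, fun z => ?_⟩
  · have h3 := h1 ⟨mk (i w), LinearMap.mem_range_self (mk ∘ₗ i) w⟩
    change φ (mk (i w)) = A (s _) at h3
    rw [LinearMap.comp_apply, h3, ← sub_eq_zero, ← map_sub, ← norm_eq_zero, hA, ← hmk, map_sub,
      map_sub, hs', sub_self, norm_zero]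
  · have := h2 (mk z)
    rw [hmk] at this
    rw [LinearMap.comp_apply, abs_le]
    constructor <;> linarith

/-- If the tuples `a` in a Gurarij space `G` and `b` in a normed space `H` have approximately the
same type, then `a` can be moved a little so as to have the type of `b` up to an arbitrarily small
error. The reason is that the spans of `a` and `b` embed isometrically in the amalgam in which
`‖a i - b i‖ ≤ d i`. -/
theorem IsGurarij.exists_tuple_near {G : Type u} [NormedAddCommGroup G] [NormedSpace ℝ G]
    (hG : IsGurarij G) {H : Type v} [NormedAddCommGroup H] [NormedSpace ℝ H] {n : ℕ}
    (a : Fin n → G) (b : Fin n → H) (d : Fin n → ℝ) (hd : ∀ i, 0 ≤ d i)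
    (h : ∀ c : Fin n → ℝ, |‖∑ i, c i • a i‖ - ‖∑ i, c i • b i‖| ≤ ∑ i, d i * |c i|)
    {ε : ℝ} (hε : 0 < ε) :
    ∃ a' : Fin n → G, (∀ i, ‖a' i - a i‖ ≤ d i + ε) ∧
      ∀ c : Fin n → ℝ, |‖∑ i, c i • a' i‖ - ‖∑ i, c i • b i‖| ≤ ε * ∑ i, |c i| := by
  classical
  let A : (Fin n → ℝ) →ₗ[ℝ] G := Fintype.linearCombination ℝ a
  let B : (Fin n → ℝ) →ₗ[ℝ] H := Fintype.linearCombination ℝ b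
  have hAd : ∀ c, A c = ∑ i, c i • a i := fun c => Fintype.linearCombination_apply ℝ a c
  have hBd : ∀ c, B c = ∑ i, c i • b i := fun c => Fintype.linearCombination_apply ℝ b c
  simp only [← hAd, ← hBd] at h
  let P : Seminorm ℝ ((Fin n → ℝ) × (Fin n → ℝ)) :=
    (normSeminorm ℝ G).comp (A ∘ₗ LinearMap.fst ℝ _ _) +
      (normSeminorm ℝ H).comp (B ∘ₗ LinearMap.snd ℝ _ _)
  have hP : ∀ x y, P (x, y) = ‖A x‖ + ‖B y‖ := fun x y => rfl
  let r : Seminorm ℝ (Fin n → ℝ) := Seminorm.of (fun c => ∑ i, d i * |c i|)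
    (fun x y => by
      rw [← Finset.sum_add_distrib]
      refine Finset.sum_le_sum fun i _ => ?_
      rw [← mul_add]
      exact mul_le_mul_of_nonneg_left (abs_add_le _ _) (hd i))
    (fun t x => by
      rw [Finset.mul_sum]
      refine Finset.sum_congr rfl fun i _ => ?_
      simp only [Pi.smul_apply, smul_eq_mul, abs_mul, Real.norm_eq_abs]; ring)
  have hr : ∀ c, r c = ∑ i, d i * |c i| := fun c => rfl
  simp only [← hr] at h
  let j : (Fin n → ℝ) →ₗ[ℝ] (Fin n → ℝ) × (Fin n → ℝ) := LinearMap.prod LinearMap.id (-LinearMap.id)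
  have hj : ∀ x, j x = (x, -x) := fun x => rfl
  -- the norm of the amalgam, in which `‖a i - b i‖ ≤ d i`
  let N := P.infConv j r
  have hN1 : ∀ x, ‖A x‖ = N (x, 0) := fun x => by
    refine le_antisymm (Seminorm.le_infConv fun w => ?_) ?_
    · rw [hj, Prod.mk_sub_mk, hP, zero_sub, neg_neg, map_sub]
      have h1 := (abs_le.1 (h w)).2
      have h2 := norm_le_norm_add_norm_sub' (A x) (A w)
      linarith
    · simpa [hP] using P.infConv_le_left j r (x, 0)
  have hN2 : ∀ x, ‖B x‖ = N (0, x) := fun x => by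
    refine le_antisymm (Seminorm.le_infConv fun w => ?_) ?_
    · rw [hj, Prod.mk_sub_mk, hP, zero_sub, sub_neg_eq_add, map_neg, norm_neg, map_add]
      have h1 := (abs_le.1 (h w)).1
      have h2 := norm_sub_le (B x + B w) (B w)
      rw [add_sub_cancel_right] at h2
      linarith
    · simpa [hP] using P.infConv_le_left j r (0, x)
  set S := ∑ i, d i + ∑ i, ‖b i‖ + 1 with hS
  have hS1 : ∀ i, d i ≤ S := fun i => by
    have h1 := Finset.single_le_sum (f := d) (fun i _ => hd i) (Finset.mem_univ i)
    have h2 : 0 ≤ ∑ i, ‖b i‖ := Finset.sum_nonneg fun i _ => norm_nonneg _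
    linarith
  have hS2 : ∀ i, ‖b i‖ ≤ S := fun i => by
    have h1 := Finset.single_le_sum (f := fun i => ‖b i‖) (fun i _ => norm_nonneg _)
      (Finset.mem_univ i)
    have h2 : 0 ≤ ∑ i, d i := Finset.sum_nonneg fun i _ => hd i
    linarith
  have hS0 : 0 < S := by
    have h1 : 0 ≤ ∑ i, d i := Finset.sum_nonneg fun i _ => hd i
    have h2 : 0 ≤ ∑ i, ‖b i‖ := Finset.sum_nonneg fun i _ => norm_nonneg _
    linarith
  obtain ⟨φ, hφ1, hφ2⟩ := hG.exists_extension_seminorm N (LinearMap.inl ℝ _ _) A hN1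
    (div_pos hε hS0)
  have hdiv : ∀ t, t ≤ S → ε / S * t ≤ ε := fun t ht => by
    rw [div_mul_eq_mul_div, div_le_iff₀ hS0]
    exact mul_le_mul_of_nonneg_left ht hε.le
  have ha1 : ∀ i, A (Pi.single i 1) = a i := fun i => by
    rw [hAd, Finset.sum_eq_single i] <;> simp +contextual
  refine ⟨fun i => φ (0, Pi.single i 1), fun i => ?_, fun c => ?_⟩
  · have h1 : φ (0, Pi.single i 1) - a i = φ (j (-Pi.single i 1)) := by
      rw [← ha1 i, ← hφ1, ← map_sub, hj]; simp
    have h2 := (abs_le.1 (hφ2 (j (-Pi.single i 1)))).2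
    have h3 : N (j (-Pi.single i 1)) ≤ d i := by
      refine (P.infConv_apply_le j r _).trans (le_of_eq ?_)
      rw [hr, Finset.sum_eq_single i] <;> simp +contextual
    have h4 := hdiv _ (h3.trans (hS1 i))
    rw [h1]; linarith
  · have h1 : ∑ i, c i • φ (0, Pi.single i 1) = φ (0, c) := by
      change _ = (φ ∘ₗ LinearMap.inr ℝ _ _) c
      rw [LinearMap.pi_apply_eq_sum_univ (φ ∘ₗ LinearMap.inr ℝ _ _) c]
      refine Finset.sum_congr rfl fun i _ => ?_
      have hs : (Pi.single i 1 : Fin n → ℝ) = fun k => if i = k then 1 else 0 := by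
        ext k; simp [Pi.single_apply, eq_comm]
      rw [hs]; rfl
    have h2 := hφ2 (0, c)
    rw [← hN2] at h2
    rw [h1, ← hBd]
    refine h2.trans ?_
    rw [hBd, Finset.mul_sum]
    calc ε / S * ‖∑ i, c i • b i‖ ≤ ε / S * ∑ i, |c i| * S := by
          refine mul_le_mul_of_nonneg_left ?_ (by positivity)
          refine (norm_sum_le _ _).trans (Finset.sum_le_sum fun i _ => ?_)
          rw [norm_smul, Real.norm_eq_abs]
          exact mul_le_mul_of_nonneg_left (hS2 i) (abs_nonneg _)
      _ = ∑ i, ε * |c i| := by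
          rw [Finset.mul_sum]
          refine Finset.sum_congr rfl fun i _ => ?_
          field_simp

end ApproximateExtension

section BackAndForth

variable {G : Type u} [NormedAddCommGroup G] [NormedSpace ℝ G]
  {H : Type v} [NormedAddCommGroup H] [NormedSpace ℝ H]

/-- The first `n` entries of the sequences `a` and `b` have the same type up to `δ`: corresponding
linear combinations have the same norm up to `δ` times the `ℓ¹`-norm of the coefficients. -/
def ApproxIsometric (n : ℕ) (δ : ℝ) (a : ℕ → G) (b : ℕ → H) : Prop :=
  ∀ c : ℕ → ℝ, |‖∑ i ∈ Finset.range n, c i • a i‖ - ‖∑ i ∈ Finset.range n, c i • b i‖| ≤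
    δ * ∑ i ∈ Finset.range n, |c i|

theorem ApproxIsometric.symm {n : ℕ} {δ : ℝ} {a : ℕ → G} {b : ℕ → H}
    (h : ApproxIsometric n δ a b) : ApproxIsometric n δ b a := fun c => by
  rw [abs_sub_comm]; exact h c

theorem Finset.sum_range_ite_lt {M : Type*} [AddCommMonoid M] {m n : ℕ} (hmn : m ≤ n) (f : ℕ → M) :
    ∑ i ∈ Finset.range n, (if i < m then f i else 0) = ∑ i ∈ Finset.range m, f i := by
  rw [← Finset.sum_filter]
  congr 1
  ext i
  simp only [Finset.mem_filter, Finset.mem_range]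
  omega

theorem ApproxIsometric.mono {m n : ℕ} {δ : ℝ} {a : ℕ → G} {b : ℕ → H}
    (h : ApproxIsometric n δ a b) (hmn : m ≤ n) : ApproxIsometric m δ a b := fun c => by
  have h1 := h fun i => if i < m then c i else 0
  simpa only [ite_smul, zero_smul, apply_ite abs, abs_zero, Finset.sum_range_ite_lt hmn] using h1

/-- One half of a back-and-forth step: the next entry of `b` is prescribed. -/
theorem IsGurarij.exists_approxIsometric_succ (hG : IsGurarij G) {n : ℕ} {δ : ℝ} (hδ : 0 ≤ δ)
    {a : ℕ → G} {b : ℕ → H} (hab : ApproxIsometric n δ a b) (y : H) {ε : ℝ} (hε : 0 < ε) :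
    ∃ a' : ℕ → G, ApproxIsometric (n + 1) ε a' (Function.update b n y) ∧
      ∀ i < n, ‖a' i - a i‖ ≤ δ + ε := by
  set b' := Function.update b n y with hb'
  have hbn : ∀ i < n, b' i = b i := fun i hi => Function.update_of_ne hi.ne _ _
  -- the `n`-th entry may move arbitrarily far
  let d : Fin (n + 1) → ℝ := fun i => if (i : ℕ) < n then δ else ‖a n‖ + ‖y‖
  have hd : ∀ i, 0 ≤ d i := fun i => by
    simp only [d]; split_ifs <;> positivity
  obtain ⟨a', h1, h2⟩ := hG.exists_tuple_near (fun i : Fin (n + 1) => a i)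
    (fun i : Fin (n + 1) => b' i) d hd (fun c => by
      let c' : ℕ → ℝ := fun i => if h : i < n + 1 then c ⟨i, h⟩ else 0
      have hc : ∀ i : Fin (n + 1), c i = c' i := fun i => by simp only [c', i.2, dite_true, Fin.eta]
      have hdn : ∑ i, d i * |c i| =
          δ * ∑ i ∈ Finset.range n, |c' i| + (‖a n‖ + ‖y‖) * |c' n| := by
        simp only [hc]
        rw [Fin.sum_univ_castSucc, Finset.mul_sum, Finset.sum_range]
        simp [d]
      rw [hdn]
      simp only [hc]
      rw [← Finset.sum_range (fun i => c' i • a i), ← Finset.sum_range (fun i => c' i • b' i),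
        Finset.sum_range_succ, Finset.sum_range_succ]
      have hs : ∑ i ∈ Finset.range n, c' i • b' i = ∑ i ∈ Finset.range n, c' i • b i :=
        Finset.sum_congr rfl fun i hi => by rw [hbn i (Finset.mem_range.1 hi)]
      have hy : b' n = y := Function.update_self _ _ _
      rw [hs, hy]
      have h3 := hab c'
      set s := ∑ i ∈ Finset.range n, c' i • a i
      set t := ∑ i ∈ Finset.range n, c' i • b i
      have h4 := abs_norm_sub_norm_le (s + c' n • a n) s
      have h5 := abs_norm_sub_norm_le (t + c' n • y) t
      rw [add_sub_cancel_left, norm_smul, Real.norm_eq_abs] at h4 h5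
      rw [abs_le] at h3 h4 h5 ⊢
      constructor <;> nlinarith) hε
  refine ⟨fun i => if h : i < n + 1 then a' ⟨i, h⟩ else 0, fun c => ?_, fun i hi => ?_⟩
  · have := h2 fun i => c i
    simpa only [Finset.sum_range, Fin.is_lt, dite_true, Fin.eta] using this
  · have := h1 ⟨i, by omega⟩
    simpa [d, hi, Nat.lt_succ_of_lt hi] using this

/-- A full back-and-forth step: two entries are added, the first one prescribed in `H` and the
second one in `G`. -/
theorem IsGurarij.exists_approxIsometric_add_two (hG : IsGurarij G) (hH : IsGurarij H) {n : ℕ}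
    {δ : ℝ} (hδ : 0 ≤ δ) {a : ℕ → G} {b : ℕ → H} (hab : ApproxIsometric n δ a b) (x : G) (y : H)
    {ε : ℝ} (hε : 0 < ε) :
    ∃ (a' : ℕ → G) (b' : ℕ → H), ApproxIsometric (n + 2) ε a' b' ∧
      (∀ i < n, ‖a' i - a i‖ ≤ δ + ε) ∧ (∀ i < n, ‖b' i - b i‖ ≤ ε + ε) ∧
      a' (n + 1) = x ∧ ‖b' n - y‖ ≤ ε + ε := by
  obtain ⟨a₁, h1, h2⟩ := hG.exists_approxIsometric_succ hδ hab y hε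
  obtain ⟨b₂, h3, h4⟩ := hH.exists_approxIsometric_succ hε.le h1.symm x hε
  refine ⟨Function.update a₁ (n + 1) x, b₂, h3.symm, fun i hi => ?_, fun i hi => ?_,
    Function.update_self _ _ _, ?_⟩
  · rw [Function.update_of_ne (by omega)]; exact h2 i hi
  · have := h4 i (by omega)
    rwa [Function.update_of_ne hi.ne] at this
  · have := h4 n (by omega)
    rwa [Function.update_self] at this

theorem exists_seq_of_forall_exists_next {S : Type*} (P : ℕ → S → Prop) (R : ℕ → S → S → Prop)
    {s₀ : S} (h₀ : P 0 s₀) (h : ∀ n s, P n s → ∃ t, P (n + 1) t ∧ R n s t) :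
    ∃ f : ℕ → S, ∀ n, P n (f n) ∧ R n (f n) (f (n + 1)) := by
  choose! g hg using h
  let f : ℕ → S := fun n => Nat.rec s₀ g n
  have hP : ∀ n, P n (f n) := fun n => by
    induction n with
    | zero => exact h₀
    | succ n ih => exact (hg n _ ih).1
  exact ⟨f, fun n => ⟨hP n, (hg n _ (hP n)).2⟩⟩

theorem exists_limit_of_geometric_tail {G : Type u} [NormedAddCommGroup G] [CompleteSpace G] {x : ℕ → G} {K : ℕ}
    (h : ∀ k ≥ K, ‖x (k + 1) - x k‖ ≤ 2 * (1 / 2) ^ k) :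
    ∃ l, Filter.Tendsto x Filter.atTop (𝓝 l) ∧ ∀ k ≥ K, ‖x k - l‖ ≤ 4 * (1 / 2) ^ k := by
  have h' : ∀ m ≥ K, ∀ k, dist (x (k + m)) (x (k + 1 + m)) ≤ 4 * (1 / 2) ^ m / 2 / 2 ^ k := by
    intro m hm k
    rw [dist_comm, dist_eq_norm, show k + 1 + m = k + m + 1 by ring]
    refine (h (k + m) (by omega)).trans (le_of_eq ?_)
    rw [pow_add, one_div_pow]; ring
  obtain ⟨l, hl⟩ := cauchySeq_tendsto_of_complete (cauchySeq_of_le_geometric_two (h' K le_rfl))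
  have hl' := (Filter.tendsto_add_atTop_iff_nat K).1 hl
  refine ⟨l, hl', fun k hk => ?_⟩
  have := dist_le_of_le_geometric_two_of_tendsto₀ (h' k hk)
    ((Filter.tendsto_add_atTop_iff_nat k).2 hl')
  simpa [dist_eq_norm] using this

/-- A sequence each tail of which is dense. -/
theorem exists_seq_forall_frequently_near (G : Type u) [NormedAddCommGroup G]
    [TopologicalSpace.SeparableSpace G] :
    ∃ g : ℕ → G, ∀ x : G, ∀ ε > 0, ∀ K, ∃ k ≥ K, ‖x - g k‖ < ε := by
  refine ⟨fun k => TopologicalSpace.denseSeq G k.unpair.1, fun x ε hε K => ?_⟩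
  obtain ⟨m, hm⟩ := (TopologicalSpace.denseRange_denseSeq G).exists_dist_lt x hε
  refine ⟨Nat.pair m K, Nat.right_le_pair m K, ?_⟩
  simpa only [Nat.unpair_pair, ← dist_eq_norm] using hm

theorem denseRange_linearCombination_of_dense {a g : ℕ → G} {i : ℕ → ℕ}
    (hg : ∀ x : G, ∀ ε > 0, ∀ K, ∃ k ≥ K, ‖x - g k‖ < ε)
    (ha : ∀ k, ‖a (i k) - g k‖ ≤ 4 * (1 / 2) ^ k) :
    DenseRange (Finsupp.linearCombination ℝ a) := by
  refine Metric.dense_iff.2 fun x ε hε => ?_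
  obtain ⟨K, hK⟩ := exists_pow_lt_of_lt_one (show 0 < ε / 8 by positivity)
    (show (1 / 2 : ℝ) < 1 by norm_num)
  obtain ⟨k, hk, hxk⟩ := hg x (ε / 2) (by positivity) K
  refine ⟨a (i k), ?_, Finsupp.single (i k) 1, by simp⟩
  rw [Metric.mem_ball, dist_eq_norm]
  have h1 : (1 / 2 : ℝ) ^ k ≤ (1 / 2) ^ K := pow_le_pow_of_le_one (by norm_num) (by norm_num) hk
  have h2 := ha k
  have h3 := norm_sub_le_norm_sub_add_norm_sub (a (i k)) (g k) x
  rw [norm_sub_rev (g k)] at h3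
  linarith

/-- Any two Gurarij spaces are linearly isometric. A back-and-forth construction yields sequences
in `G` and `H` with dense spans and with the same norms of all linear combinations. -/
theorem IsGurarij.nonempty_linearIsometryEquiv (hG : IsGurarij G) (hH : IsGurarij H) :
    Nonempty (G ≃ₗᵢ[ℝ] H) := by
  have := hG.complete
  have := hH.complete
  have := hG.separable
  have := hH.separable
  obtain ⟨g, hg⟩ := exists_seq_forall_frequently_near G
  obtain ⟨h, hh⟩ := exists_seq_forall_frequently_near H
  have hpow : ∀ k : ℕ, (0 : ℝ) < (1 / 2) ^ k := fun k => by positivity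
  obtain ⟨f, hf⟩ := exists_seq_of_forall_exists_next (S := (ℕ → G) × (ℕ → H))
    (fun k s => ApproxIsometric (2 * k) ((1 / 2) ^ k) s.1 s.2)
    (fun k s t => (∀ i < 2 * k, ‖t.1 i - s.1 i‖ ≤ 2 * (1 / 2) ^ k) ∧
      (∀ i < 2 * k, ‖t.2 i - s.2 i‖ ≤ 2 * (1 / 2) ^ k) ∧
      ‖t.1 (2 * k + 1) - g k‖ ≤ 2 * (1 / 2) ^ (k + 1) ∧ ‖t.2 (2 * k) - h k‖ ≤ 2 * (1 / 2) ^ (k + 1))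
    (s₀ := (0, 0)) (fun c => by simp) (fun k s hs => by
      obtain ⟨a', b', h1, h2, h3, h4, h5⟩ := hG.exists_approxIsometric_add_two hH (hpow k).le hs
        (g k) (h k) (hpow (k + 1))
      have hk : (1 / 2 : ℝ) ^ (k + 1) = (1 / 2) ^ k / 2 := by rw [pow_succ]; ring
      have := hpow k
      refine ⟨(a', b'), h1, fun i hi => (h2 i hi).trans ?_, fun i hi => (h3 i hi).trans ?_,
        ?_, h5.trans ?_⟩
      · linarith
      · linarith
      · simp only [h4, sub_self, norm_zero]; linarith
      · linarith)
  choose hP h1 h2 h3 h4 using hf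
  -- the `i`-th entries are controlled as soon as `i < 2 * k`
  choose a ha ha' using fun i => exists_limit_of_geometric_tail (x := fun k => (f k).1 i)
    (K := i / 2 + 1) (fun k hk => h1 k i (by omega))
  choose b hb hb' using fun i => exists_limit_of_geometric_tail (x := fun k => (f k).2 i)
    (K := i / 2 + 1) (fun k hk => h2 k i (by omega))
  have hnorm : ∀ (n : ℕ) (c : ℕ → ℝ),
      ‖∑ i ∈ Finset.range n, c i • a i‖ = ‖∑ i ∈ Finset.range n, c i • b i‖ := by
    intro n c
    have l1 : Filter.Tendsto (fun k => ‖∑ i ∈ Finset.range n, c i • (f k).1 i‖ -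
        ‖∑ i ∈ Finset.range n, c i • (f k).2 i‖) Filter.atTop
        (𝓝 (‖∑ i ∈ Finset.range n, c i • a i‖ - ‖∑ i ∈ Finset.range n, c i • b i‖)) :=
      (tendsto_finsetSum _ fun i _ => (ha i).const_smul (c i)).norm.sub
        (tendsto_finsetSum _ fun i _ => (hb i).const_smul (c i)).norm
    have l2 : Filter.Tendsto (fun k : ℕ => (1 / 2 : ℝ) ^ k * ∑ i ∈ Finset.range n, |c i|)
        Filter.atTop (𝓝 0) := by
      simpa using (tendsto_pow_atTop_nhds_zero_of_lt_one (r := (1 / 2 : ℝ)) (by norm_num)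
        (by norm_num)).mul_const (∑ i ∈ Finset.range n, |c i|)
    have l3 := le_of_tendsto_of_tendsto l1.abs l2 (Filter.eventually_atTop.2 ⟨n, fun k hk =>
      (hP k).mono (by omega) c⟩)
    exact sub_eq_zero.1 (abs_nonpos_iff.1 l3)
  have hk : ∀ k : ℕ, (1 / 2 : ℝ) ^ (k + 1) = (1 / 2) ^ k / 2 := fun k => by rw [pow_succ]; ring
  have hda : DenseRange (Finsupp.linearCombination ℝ a) :=
    denseRange_linearCombination_of_dense (i := fun k => 2 * k + 1) hg fun k => by
      have t1 := ha' (2 * k + 1) (k + 1) (by omega)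
      have t2 := norm_sub_le_norm_sub_add_norm_sub (a (2 * k + 1)) ((f (k + 1)).1 (2 * k + 1)) (g k)
      rw [norm_sub_rev (a _) ((f (k + 1)).1 _)] at t2
      have t3 := h3 k
      have t4 := hpow k
      rw [hk] at t1 t3
      linarith
  have hdb : DenseRange (Finsupp.linearCombination ℝ b) :=
    denseRange_linearCombination_of_dense (i := fun k => 2 * k) hh fun k => by
      have t1 := hb' (2 * k) (k + 1) (by omega)
      have t2 := norm_sub_le_norm_sub_add_norm_sub (b (2 * k)) ((f (k + 1)).2 (2 * k)) (h k)
      rw [norm_sub_rev (b _) ((f (k + 1)).2 _)] at t2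
      have t3 := h4 k
      have t4 := hpow k
      rw [hk] at t1 t3
      linarith
  refine ⟨(LinearEquiv.refl ℝ (ℕ →₀ ℝ)).extendOfIsometry (Finsupp.linearCombination ℝ a)
    (Finsupp.linearCombination ℝ b) hda hdb fun c => ?_⟩
  obtain ⟨n, hn⟩ := c.support.exists_nat_subset_range
  rw [LinearEquiv.refl_apply, Finsupp.linearCombination_apply, Finsupp.linearCombination_apply,
    Finsupp.sum_of_support_subset c hn _ (by simp), Finsupp.sum_of_support_subset c hn _ (by simp)]
  exact (hnorm n c).symm

end BackAndForth

/-! ### Realising one-dimensional extensions in a space of continuous functions -/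

section DualBall

variable (X : Type u) [NormedAddCommGroup X] [NormedSpace ℝ X]

/-- The closed unit ball of the dual of `X`, with the weak-* topology. -/
abbrev DualBall : Type u :=
  ↥(WeakDual.toStrongDual ⁻¹' Metric.closedBall (0 : StrongDual ℝ X) 1 : Set (WeakDual ℝ X))

instance DualBall.compactSpace : CompactSpace (DualBall X) :=
  isCompact_iff_compactSpace.1 (WeakDual.isCompact_closedBall 0 1)

instance DualBall.secondCountableTopology [TopologicalSpace.SeparableSpace X] :
    SecondCountableTopology (DualBall X) := by
  have : TopologicalSpace.MetrizableSpace (DualBall X) :=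
    WeakDual.metrizable_of_isCompact ℝ X _ (WeakDual.isCompact_closedBall 0 1)
  let := TopologicalSpace.metrizableSpaceMetric (DualBall X)
  infer_instance

variable {X}

theorem DualBall.abs_apply_le (l : DualBall X) (x : X) : |l.1 x| ≤ ‖x‖ := by
  have h : ‖WeakDual.toStrongDual l.1‖ ≤ 1 :=
    mem_closedBall_zero_iff.1 l.2
  simpa using (WeakDual.toStrongDual l.1).le_of_opNorm_le h x

/-- The element of the dual ball given by a linear functional dominated by the norm. -/
noncomputable def DualBall.mk (f : X →ₗ[ℝ] ℝ) (hf : ∀ x, |f x| ≤ ‖x‖) : DualBall X :=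
  ⟨StrongDual.toWeakDual (f.mkContinuous 1 fun x => by simpa using hf x),
    mem_closedBall_zero_iff.2 <| f.mkContinuous_norm_le zero_le_one (fun x => by simpa using hf x)⟩

theorem DualBall.continuous_eval : Continuous fun q : DualBall X × X => q.1.1 q.2 := by
  refine continuous_iff_continuousAt.2 fun ⟨l₀, x₀⟩ => ?_
  have h1 : Filter.Tendsto (fun q : DualBall X × X => q.1.1 (q.2 - x₀)) (𝓝 (l₀, x₀)) (𝓝 0) := by
    refine squeeze_zero_norm (fun q => q.1.abs_apply_le _) ?_
    have : Continuous fun q : DualBall X × X => ‖q.2 - x₀‖ := by fun_prop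
    simpa using this.tendsto (l₀, x₀)
  have h2 : Continuous fun q : DualBall X × X => q.1.1 x₀ :=
    (WeakDual.eval_continuous x₀).comp (continuous_subtype_val.comp continuous_fst)
  have h3 := h1.add (h2.tendsto (l₀, x₀))
  simpa [ContinuousAt] using h3

theorem DualBall.continuous_of_apply {T : Type*} [TopologicalSpace T] {f : T → DualBall X}
    (h : ∀ x, Continuous fun t => (f t).1 x) : Continuous f :=
  Continuous.subtype_mk (WeakDual.continuous_of_continuous_eval h) _

variable (X)

/-- The space of continuous functions on `DualBall X × [0, 1]`. -/
abbrev DualBallMaps : Type u := C(DualBall X × unitInterval, ℝ)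

/-- The canonical isometric embedding of `X` in the space of functions on its dual ball. -/
noncomputable def dualBallEval : X →ₗᵢ[ℝ] DualBallMaps X where
  toFun x := ⟨fun q => q.1.1 x, (WeakDual.eval_continuous x).comp
    (continuous_subtype_val.comp continuous_fst)⟩
  map_add' x y := by ext q; simp
  map_smul' t x := by ext q; simp
  norm_map' x := by
    refine le_antisymm ((ContinuousMap.norm_le _ (norm_nonneg x)).2 fun q => ?_) ?_
    · exact q.1.abs_apply_le x
    · obtain ⟨f, hf, hfx⟩ := (normSeminorm ℝ X).exists_dual_apply_eq x
      have h := ContinuousMap.norm_coe_le_norm (⟨fun q => q.1.1 x, (WeakDual.eval_continuous x).comp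
        (continuous_subtype_val.comp continuous_fst)⟩ : DualBallMaps X) (DualBall.mk f hfx, 0)
      refine le_trans (le_of_eq ?_) h
      have hx : ‖x‖ = |f x| := by rw [hf]; exact (abs_norm x).symm
      exact hx

end DualBall

section UpperValue

variable {F : Type u} [NormedAddCommGroup F] [NormedSpace ℝ F]

/-- The greatest value at `v` allowed, by the elements of `K` alone, for an extension of the
functional `f` that is dominated by the seminorm `p`. -/
noncomputable def upperValue (p : Seminorm ℝ F) (K : Set F) (v : F) (f : F → ℝ) : ℝ :=
  sInf ((fun e => p (v + e) - f e) '' K)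

variable {p : Seminorm ℝ F} {E : Submodule ℝ F} {K : Set F} {v : F}

theorem upperValue_le {f : F →ₗ[ℝ] ℝ} (hf : ∀ e ∈ E, |f e| ≤ p e) (hK : K ⊆ E) {e : F}
    (he : e ∈ K) : upperValue p K v f ≤ p (v + e) - f e := by
  refine csInf_le ⟨-p v, ?_⟩ ⟨e, he, rfl⟩
  rintro _ ⟨e, he, rfl⟩
  have h1 := le_of_abs_le (hf e (hK he))
  have h2 := map_sub_le_add p (v + e) v
  rw [add_sub_cancel_left] at h2
  dsimp only
  linarith

/-- The least allowed value is at most the greatest one. -/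
theorem neg_upperValue_neg_le {f : F →ₗ[ℝ] ℝ} (hf : ∀ e ∈ E, |f e| ≤ p e) (hK : K ⊆ E)
    (h0 : (0 : F) ∈ K) : -upperValue p K v (-f : F →ₗ[ℝ] ℝ) ≤ upperValue p K v f := by
  refine le_csInf (Set.Nonempty.image _ ⟨0, h0⟩) ?_
  rintro _ ⟨e, he, rfl⟩
  rw [neg_le]
  refine le_csInf (Set.Nonempty.image _ ⟨0, h0⟩) ?_
  rintro _ ⟨e', he', rfl⟩
  have h1 := le_of_abs_le (hf (e - e') (E.sub_mem (hK he) (hK he')))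
  have h2 := map_sub_le_add p (v + e) (v + e')
  rw [add_sub_add_left_eq_sub] at h2
  rw [map_sub] at h1
  simp only [LinearMap.neg_apply]
  linarith

theorem le_upperValue {f μ : F →ₗ[ℝ] ℝ} (hμ : ∀ x, |μ x| ≤ p x) (hfμ : ∀ e ∈ E, f e = μ e)
    (hK : K ⊆ E) (h0 : (0 : F) ∈ K) : μ v ≤ upperValue p K v f := by
  refine le_csInf (Set.Nonempty.image _ ⟨0, h0⟩) ?_
  rintro _ ⟨e, he, rfl⟩
  have h1 := le_of_abs_le (hμ (v + e))
  rw [map_add] at h1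
  dsimp only
  rw [hfμ e (hK he)]
  linarith

/-- Elements of norm greater than `R` may be ignored in the definition of the upper value, at the
price of an error of `2 * p v / R`. -/
theorem add_mul_upperValue_le {f : F →ₗ[ℝ] ℝ} (hf : ∀ e ∈ E, |f e| ≤ p e) {R ε : ℝ} (hR : 0 < R)
    (hε : 2 * p v ≤ ε * R) {x : F} (hx : x ∈ E) {t : ℝ} (ht : 0 ≤ t) :
    f x + t * upperValue p {e | e ∈ E ∧ ‖e‖ ≤ R} v f ≤ p (x + t • v) + ε * ‖x‖ := by
  have hε0 : 0 ≤ ε := by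
    have : 0 ≤ 2 * p v := by positivity
    exact nonneg_of_mul_nonneg_left (this.trans hε) hR
  have hK : {e | e ∈ E ∧ ‖e‖ ≤ R} ⊆ (E : Set F) := fun e he => he.1
  have hfx := le_of_abs_le (hf x hx)
  have hεx : 0 ≤ ε * ‖x‖ := by positivity
  obtain rfl | ht := ht.eq_or_lt
  · simp only [zero_mul, add_zero, zero_smul]; linarith
  by_cases hxR : ‖x‖ ≤ t * R
  · have he : t⁻¹ • x ∈ {e | e ∈ E ∧ ‖e‖ ≤ R} := by
      refine ⟨E.smul_mem _ hx, ?_⟩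
      rw [norm_smul, Real.norm_eq_abs, abs_of_pos (inv_pos.2 ht), inv_mul_le_iff₀ ht]
      exact hxR
    have h1 := mul_le_mul_of_nonneg_left (upperValue_le (v := v) hf hK he) ht.le
    have h2 : t * p (v + t⁻¹ • x) = p (x + t • v) := by
      have := map_smul_eq_mul p t (v + t⁻¹ • x)
      rw [Real.norm_eq_abs, abs_of_pos ht] at this
      rw [← this, smul_add, smul_inv_smul₀ ht.ne', add_comm]
    have h3 : t * f (t⁻¹ • x) = f x := by
      rw [map_smul, smul_eq_mul, mul_inv_cancel_left₀ ht.ne']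
    rw [mul_sub, h2, h3] at h1
    linarith
  · have h1 := mul_le_mul_of_nonneg_left (upperValue_le (v := v) hf hK
      (show (0 : F) ∈ {e | e ∈ E ∧ ‖e‖ ≤ R} from ⟨E.zero_mem, by simpa using hR.le⟩)) ht.le
    rw [add_zero, map_zero, sub_zero] at h1
    have h2 := map_sub_le_add p (x + t • v) (t • v)
    rw [add_sub_cancel_right, map_smul_eq_mul, Real.norm_eq_abs, abs_of_pos ht] at h2
    have h3 := mul_le_mul_of_nonneg_left hε ht.le
    have h4 := mul_le_mul_of_nonneg_left (not_le.1 hxR).le hε0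
    nlinarith

/-- Compactness of `K` is what makes the upper value continuous in the functional. -/
theorem continuous_upperValue {T : Type v} [TopologicalSpace T] (hp : Continuous p)
    (hK : IsCompact K) {f : T → F → ℝ} (hf : Continuous fun q : T × F => f q.1 q.2) :
    Continuous fun t => upperValue p K v (f t) := by
  refine hK.continuous_sInf (f := fun t e => p (v + e) - f t e) ?_
  exact (hp.comp (continuous_const.add continuous_snd)).sub hf

end UpperValue

/-- Every one-dimensional extension of a finite-dimensional almost isometric piece of `X` is almost
realised by a continuous function on `DualBall X × [0, 1]`. At a functional `l` in the dual ball the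
value of this function runs, along `[0, 1]`, through all values that an extension of `l` to the new
vector can take. -/
theorem exists_dualBallMaps_realising {X : Type u} [NormedAddCommGroup X] [NormedSpace ℝ X]
    {F : Type v} [NormedAddCommGroup F] [NormedSpace ℝ F] [FiniteDimensional ℝ F]
    (E : Submodule ℝ F) (ψ : F →ₗ[ℝ] X) {δ : ℝ} (hδ : 0 ≤ δ)
    (hψ : ∀ x ∈ E, |‖ψ x‖ - ‖x‖| ≤ δ * ‖x‖) (v : F) {ε : ℝ} (hε : 0 < ε) :
    ∃ g : DualBallMaps X, ∀ x ∈ E, ∀ t : ℝ,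
      |‖dualBallEval X (ψ x) + t • g‖ - ‖x + t • v‖| ≤ δ * ‖x + t • v‖ + ε * ‖x‖ := by
  have : ProperSpace F := FiniteDimensional.proper_real F
  let P : Seminorm ℝ F := Real.toNNReal (1 + δ) • normSeminorm ℝ F
  have hP : ∀ x, P x = (1 + δ) * ‖x‖ := fun x =>
    congrArg (· * ‖x‖) (Real.coe_toNNReal (1 + δ) (by positivity))
  -- `p` differs from the norm of `F` by a factor in `[1 - δ, 1 + δ]`, and makes `ψ` isometric on `E`
  let p : Seminorm ℝ F := P.infConv E.subtype ((normSeminorm ℝ X).comp (ψ ∘ₗ E.subtype))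
  have hp_le : ∀ x, p x ≤ (1 + δ) * ‖x‖ := fun x =>
    (P.infConv_le_left _ _ x).trans_eq (hP x)
  have hp_ge : ∀ x, (1 - δ) * ‖x‖ ≤ p x := fun x => Seminorm.le_infConv fun w => by
    rw [hP]
    change _ ≤ ‖ψ w‖ + (1 + δ) * ‖x - w‖
    have h1 := (abs_le.1 (hψ w w.2)).1
    have h2 := norm_le_norm_add_norm_sub' x (w : F)
    have h3 := norm_le_norm_add_norm_sub' (w : F) x
    rw [norm_sub_rev] at h3
    nlinarith
  have hpE : ∀ x ∈ E, p x = ‖ψ x‖ := fun x hx => by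
    refine le_antisymm (P.infConv_apply_le _ _ (⟨x, hx⟩ : E)) (Seminorm.le_infConv fun w => ?_)
    rw [hP]
    change _ ≤ ‖ψ w‖ + (1 + δ) * ‖x - w‖
    have h1 := (abs_le.1 (hψ _ (E.sub_mem hx w.2))).2
    have h2 := norm_le_norm_add_norm_sub' (ψ x) (ψ w)
    rw [← map_sub] at h2
    linarith
  have hp_cont : Continuous p := by
    refine Seminorm.continuous_of_le ?_ (fun x => (hp_le x).trans_eq (hP x).symm : p ≤ P)
    exact (continuous_const.mul continuous_norm).congr fun x => (hP x).symm
  -- the radius is such that `add_mul_upperValue_le` applies with the error `ε`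
  set R : ℝ := (2 * p v + 1) / ε with hR
  have hpv : 0 ≤ p v := apply_nonneg p v
  have hR0 : 0 < R := by positivity
  have hRε : 2 * p v ≤ ε * R := by rw [hR, mul_div_cancel₀ _ hε.ne']; linarith
  set K : Set F := {e | e ∈ E ∧ ‖e‖ ≤ R} with hKd
  have hKE : K ⊆ E := fun e he => he.1
  have hK0 : (0 : F) ∈ K := ⟨E.zero_mem, by simpa using hR0.le⟩
  have hK : IsCompact K := by
    have : K = (E : Set F) ∩ Metric.closedBall 0 R := by ext; simp [hKd]
    rw [this]
    exact (isCompact_closedBall 0 R).inter_left E.closed_of_finiteDimensional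
  let L : DualBall X → F →ₗ[ℝ] ℝ := fun l => l.1.toLinearMap ∘ₗ ψ
  have hLE : ∀ l, ∀ e ∈ E, |L l e| ≤ p e := fun l e he => by
    rw [hpE e he]; exact l.abs_apply_le _
  have hLE' : ∀ l, ∀ e ∈ E, |(-L l) e| ≤ p e := fun l e he => by
    rw [LinearMap.neg_apply, abs_neg]; exact hLE l e he
  have hLc : Continuous fun q : DualBall X × F => L q.1 q.2 :=
    DualBall.continuous_eval.comp (continuous_fst.prodMk
      (ψ.continuous_of_finiteDimensional.comp continuous_snd))
  let hi : DualBall X → ℝ := fun l => upperValue p K v (L l)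
  let lo : DualBall X → ℝ := fun l => -upperValue p K v (-L l : F →ₗ[ℝ] ℝ)
  have hhi : Continuous hi := continuous_upperValue hp_cont hK hLc
  have hlo : Continuous lo := (continuous_upperValue hp_cont hK
    (f := fun l x => (-L l : F →ₗ[ℝ] ℝ) x) hLc.neg).neg
  have hlohi : ∀ l, lo l ≤ hi l := fun l => neg_upperValue_neg_le (hLE l) hKE hK0
  let g : DualBallMaps X := ⟨fun q => lo q.1 + q.2 * (hi q.1 - lo q.1), by fun_prop⟩
  have hg : ∀ q, g q = lo q.1 + q.2 * (hi q.1 - lo q.1) := fun q => rfl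
  have hglo : ∀ q, lo q.1 ≤ g q := fun q => by
    have := mul_nonneg q.2.2.1 (sub_nonneg.2 (hlohi q.1))
    rw [hg]; linarith
  have hghi : ∀ q, g q ≤ hi q.1 := fun q => by
    have := mul_le_mul_of_nonneg_right q.2.2.2 (sub_nonneg.2 (hlohi q.1))
    rw [hg]; linarith
  refine ⟨g, fun x hx t => ?_⟩
  have hval : ∀ (x : F) (t : ℝ) q, (dualBallEval X (ψ x) + t • g) q = L q.1 x + t * g q :=
    fun x t q => rfl
  have hupper : ∀ x ∈ E, ∀ (t : ℝ) q, L q.1 x + t * g q ≤ p (x + t • v) + ε * ‖x‖ := by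
    intro x hx t q
    obtain ht | ht := le_total 0 t
    · have h1 := add_mul_upperValue_le (hLE q.1) hR0 hRε hx ht
      have h2 := mul_le_mul_of_nonneg_left (hghi q) ht
      linarith
    · have h1 := add_mul_upperValue_le (hLE' q.1) hR0 hRε (E.neg_mem hx) (neg_nonneg.2 ht)
      have h2 := mul_le_mul_of_nonneg_left (hglo q) (neg_nonneg.2 ht)
      have h3 : -x + -t • v = -(x + t • v) := by rw [neg_smul, neg_add]
      rw [h3, map_neg_eq_map p, norm_neg, LinearMap.neg_apply, (L q.1).map_neg, neg_neg] at h1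
      simp only [lo] at h2
      linarith
  have h1 : ‖dualBallEval X (ψ x) + t • g‖ ≤ p (x + t • v) + ε * ‖x‖ := by
    refine (ContinuousMap.norm_le _ (by positivity)).2 fun q => ?_
    rw [hval, Real.norm_eq_abs, abs_le]
    refine ⟨?_, hupper x hx t q⟩
    have := hupper (-x) (E.neg_mem hx) (-t) q
    have h3 : -x + -t • v = -(x + t • v) := by rw [neg_smul, neg_add]
    rw [h3, map_neg_eq_map p, norm_neg, (L q.1).map_neg] at this
    linarith
  -- a norming functional on `F` restricts to a functional in the dual ball of `X`, and its value at
  -- `v` is attained by `g` over that functional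
  have h2 : p (x + t • v) ≤ ‖dualBallEval X (ψ x) + t • g‖ := by
    obtain ⟨μ, hμ, hμp⟩ := p.exists_dual_apply_eq (x + t • v)
    obtain ⟨f, hf, hfX⟩ := (ψ ∘ₗ E.subtype).exists_dual_comp_eq (normSeminorm ℝ X)
      (μ ∘ₗ E.subtype) (fun w => by
        have := hμp w
        rwa [hpE w w.2] at this)
    let l : DualBall X := DualBall.mk f hfX
    have hfμ : ∀ e ∈ E, L l e = μ e := fun e he => hf ⟨e, he⟩
    have hμhi : μ v ≤ hi l := le_upperValue hμp hfμ hKE hK0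
    have hμlo : lo l ≤ μ v := by
      have := le_upperValue (f := -L l) (μ := -μ) (v := v) (E := E) (p := p)
        (fun x => by rw [LinearMap.neg_apply, abs_neg]; exact hμp x)
        (fun e he => by rw [LinearMap.neg_apply, LinearMap.neg_apply, hfμ e he]) hKE hK0
      rw [LinearMap.neg_apply] at this
      simp only [lo]
      linarith
    obtain ⟨s, hs⟩ : ∃ s : unitInterval, g (l, s) = μ v := by
      obtain ⟨s, hs, hsv⟩ := (intermediate_value_Icc (zero_le_one (α := ℝ))
        (f := fun s => lo l + s * (hi l - lo l)) (by fun_prop))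
        (show μ v ∈ Set.Icc _ _ by constructor <;> simpa)
      exact ⟨⟨s, hs⟩, hsv⟩
    have h3 := ContinuousMap.norm_coe_le_norm (dualBallEval X (ψ x) + t • g) (l, s)
    rw [hval, hs, hfμ x hx] at h3
    refine le_trans (le_of_eq ?_) ((le_abs_self _).trans h3)
    rw [← hμ, map_add, map_smul, smul_eq_mul]
  have h3 := hp_le (x + t • v)
  have h4 := hp_ge (x + t • v)
  have h5 : 0 ≤ ε * ‖x‖ := by positivity
  rw [abs_le]
  constructor <;> linarith

/-! ### Spaces with a continuous isometric action and their inductive limits -/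

/-- A separable normed space on which `Γ` acts by linear isometries, with continuous orbit maps. -/
structure ActedSpace (Γ : Type w) [Group Γ] [TopologicalSpace Γ] where
  /-- The underlying type. -/
  carrier : Type v
  [normedAddCommGroup : NormedAddCommGroup carrier]
  [normedSpace : NormedSpace ℝ carrier]
  [separableSpace : TopologicalSpace.SeparableSpace carrier]
  /-- The action. -/
  act : Γ →* (carrier →ₗᵢ[ℝ] carrier)
  continuous_act : ∀ x, Continuous fun γ => act γ x

attribute [instance] ActedSpace.normedAddCommGroup ActedSpace.normedSpace ActedSpace.separableSpace

section Completion

/-- A seminormed space with an isometric action has a completion with an isometric action. -/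
theorem Seminorm.exists_completion_action {Γ : Type w} [Group Γ] {V : Type v} [AddCommGroup V]
    [Module ℝ V] (N : Seminorm ℝ V) (ρ : Γ →* (V →ₗ[ℝ] V)) (hρ : ∀ γ x, N (ρ γ x) = N x) :
    ∃ (Y : Type v) (_ : NormedAddCommGroup Y) (_ : NormedSpace ℝ Y) (_ : CompleteSpace Y)
      (q : V →ₗ[ℝ] Y) (σ : Γ →* (Y →ₗᵢ[ℝ] Y)),
      (∀ x, ‖q x‖ = N x) ∧ DenseRange q ∧ ∀ γ x, σ γ (q x) = q (ρ γ x) := by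
  let : SeminormedAddCommGroup V := N.toAddGroupSeminorm.toSeminormedAddCommGroup
  have hN : ∀ z : V, ‖z‖ = N z := fun _ => rfl
  let : NormedSpace ℝ V := ⟨fun a x => by rw [hN, hN, map_smul_eq_mul]⟩
  let q : V →ₗ[ℝ] UniformSpace.Completion V :=
    (UniformSpace.Completion.toComplₗᵢ (𝕜 := ℝ) (E := V)).toLinearMap
  have hq : ∀ x, ‖q x‖ = N x := fun x => UniformSpace.Completion.norm_coe x
  have hd : DenseRange q := UniformSpace.Completion.denseRange_coe
  have hn : ∀ γ, ∃ C, ∀ x, ‖(q ∘ₗ ρ γ) x‖ ≤ C * ‖q x‖ := fun γ =>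
    ⟨1, fun x => by rw [LinearMap.comp_apply, hq, hq, hρ, one_mul]⟩
  let s : Γ → UniformSpace.Completion V →L[ℝ] UniformSpace.Completion V := fun γ =>
    (q ∘ₗ ρ γ).extendOfNorm q
  have hs : ∀ γ x, s γ (q x) = q (ρ γ x) := fun γ x => LinearMap.extendOfNorm_eq hd (hn γ) x
  let σ : Γ →* (UniformSpace.Completion V →ₗᵢ[ℝ] UniformSpace.Completion V) :=
    { toFun := fun γ =>
        { toLinearMap := (s γ).toLinearMap
          norm_map' := fun y => by
            refine hd.induction_on y (isClosed_eq (s γ).continuous.norm continuous_norm) fun x => ?_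
            change ‖s γ (q x)‖ = ‖q x‖
            rw [hs, hq, hq, hρ] }
      map_one' := by
        ext y
        refine hd.induction_on y (isClosed_eq (s 1).continuous continuous_id) fun x => ?_
        change s 1 (q x) = q x
        rw [hs, map_one]; rfl
      map_mul' := fun γ γ' => by
        ext y
        refine hd.induction_on y (isClosed_eq (s (γ * γ')).continuous
          ((s γ).continuous.comp (s γ').continuous)) fun x => ?_
        change s (γ * γ') (q x) = s γ (s γ' (q x))
        rw [hs, hs, hs, map_mul]; rfl }
  exact ⟨_, inferInstance, inferInstance, inferInstance, q, σ, hq, hd, hs⟩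

/-- For an action by isometries, the set of points with a continuous orbit map is closed. -/
theorem continuous_orbit_of_mem_closure {Γ : Type w} [TopologicalSpace Γ] {Y : Type v}
    [NormedAddCommGroup Y] [NormedSpace ℝ Y] (σ : Γ → (Y →ₗᵢ[ℝ] Y)) {s : Set Y}
    (hs : ∀ y ∈ s, Continuous fun γ => σ γ y) {y : Y} (hy : y ∈ closure s) :
    Continuous fun γ => σ γ y := by
  refine continuous_of_uniform_approx_of_continuous fun u hu => ?_
  obtain ⟨ε, hε, hεu⟩ := Metric.mem_uniformity_dist.1 hu
  obtain ⟨z, hz, hyz⟩ := Metric.mem_closure_iff.1 hy ε hε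
  exact ⟨fun γ => σ γ z, hs z hz, fun γ => hεu (by rwa [(σ γ).dist_map])⟩

end Completion

section Limit

variable {X : ℕ → Type v} [∀ n, NormedAddCommGroup (X n)] [∀ n, NormedSpace ℝ (X n)]
  (i : ∀ n, X n →ₗᵢ[ℝ] X (n + 1))

/-- The iterated transition map `X k → X n`, which is zero for `n < k`. -/
noncomputable def transition (k n : ℕ) : X k →ₗ[ℝ] X n :=
  if h : k ≤ n then
    Nat.leRecOn (C := fun n => X k →ₗ[ℝ] X n) h (fun {m} f => (i m).toLinearMap ∘ₗ f) LinearMap.id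
  else 0

theorem transition_self (k : ℕ) (x : X k) : transition i k k x = x := by
  rw [transition, dif_pos le_rfl, Nat.leRecOn_self, LinearMap.id_apply]

theorem transition_succ {k n : ℕ} (h : k ≤ n) (x : X k) :
    transition i k (n + 1) x = i n (transition i k n x) := by
  rw [transition, dif_pos (h.trans n.le_succ), transition, dif_pos h, Nat.leRecOn_succ h]; rfl

theorem norm_transition {k n : ℕ} (h : k ≤ n) (x : X k) : ‖transition i k n x‖ = ‖x‖ := by
  induction n, h using Nat.le_induction with
  | base => rw [transition_self]
  | succ n hn ih => rw [transition_succ i hn, LinearIsometry.norm_map, ih]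

theorem transition_succ_left {k n : ℕ} (h : k + 1 ≤ n) (x : X k) :
    transition i (k + 1) n (i k x) = transition i k n x := by
  induction n, h using Nat.le_induction with
  | base => rw [transition_self, transition_succ i le_rfl, transition_self]
  | succ n hn ih => rw [transition_succ i hn, transition_succ i (by omega), ih]

theorem transition_eq_of_coherent {d : ∀ n, X n} {k : ℕ} (hd : ∀ n ≥ k, d (n + 1) = i n (d n))
    {n : ℕ} (h : k ≤ n) : transition i k n (d k) = d n := by
  induction n, h using Nat.le_induction with
  | base => rw [transition_self]
  | succ n hn ih => rw [transition_succ i hn, ih, hd n hn]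

theorem transition_equivariant {A : ∀ n, X n → X n} (hA : ∀ n x, A (n + 1) (i n x) = i n (A n x))
    {k n : ℕ} (h : k ≤ n) (x : X k) : transition i k n (A k x) = A n (transition i k n x) := by
  induction n, h using Nat.le_induction with
  | base => rw [transition_self, transition_self]
  | succ n hn ih => rw [transition_succ i hn, transition_succ i hn, hA, ih]

/-- The sequences that are eventually coherent with respect to the transition maps. -/
def coherentSubmodule : Submodule ℝ (∀ n, X n) where
  carrier := {d | ∀ᶠ n in Filter.atTop, d (n + 1) = i n (d n)}
  add_mem' {x y} hx hy := by
    filter_upwards [hx, hy] with n h1 h2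
    simp only [Pi.add_apply, h1, h2, map_add]
  zero_mem' := by simp
  smul_mem' t x hx := by
    filter_upwards [hx] with n h1
    simp only [Pi.smul_apply, h1, map_smul]

theorem exists_transition_eq_of_mem_coherentSubmodule {d : ∀ n, X n}
    (hd : d ∈ coherentSubmodule i) : ∃ k, ∀ n ≥ k, transition i k n (d k) = d n := by
  obtain ⟨k, hk⟩ := Filter.eventually_atTop.1 hd
  exact ⟨k, fun n hn => transition_eq_of_coherent i hk hn⟩

theorem tendsto_norm_coherentSubmodule (d : coherentSubmodule i) :
    Filter.Tendsto (fun n => ‖d.1 n‖) Filter.atTop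
      (𝓝 (Filter.limUnder Filter.atTop fun n => ‖d.1 n‖)) := by
  obtain ⟨k, hk⟩ := exists_transition_eq_of_mem_coherentSubmodule i d.2
  refine tendsto_nhds_limUnder ⟨‖d.1 k‖, tendsto_const_nhds.congr' ?_⟩
  filter_upwards [Filter.eventually_ge_atTop k] with n hn
  rw [← hk n hn, norm_transition i hn]

/-- The eventual value of the norm along an eventually coherent sequence. -/
noncomputable def coherentSeminorm : Seminorm ℝ (coherentSubmodule i) :=
  Seminorm.of (fun d => Filter.limUnder Filter.atTop fun n => ‖d.1 n‖)
    (fun x y => le_of_tendsto_of_tendsto' (tendsto_norm_coherentSubmodule i (x + y))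
      ((tendsto_norm_coherentSubmodule i x).add (tendsto_norm_coherentSubmodule i y))
      fun _ => norm_add_le _ _)
    (fun t x => tendsto_nhds_unique (tendsto_norm_coherentSubmodule i (t • x))
      (((tendsto_norm_coherentSubmodule i x).const_mul ‖t‖).congr fun _ => (norm_smul _ _).symm))

theorem coherentSeminorm_eq {d : coherentSubmodule i} {r : ℝ}
    (h : ∀ᶠ n in Filter.atTop, ‖d.1 n‖ = r) : coherentSeminorm i d = r :=
  tendsto_nhds_unique (tendsto_norm_coherentSubmodule i d)
    (tendsto_const_nhds.congr' (h.mono fun _ hn => hn.symm))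

/-- The element of the limit space given by an element of `X k`. -/
noncomputable def coherentOf (k : ℕ) : X k →ₗ[ℝ] coherentSubmodule i :=
  (LinearMap.pi fun n => transition i k n).codRestrict _ fun x =>
    Filter.eventually_atTop.2 ⟨k, fun _ hn => transition_succ i hn x⟩

theorem coherentOf_apply (k : ℕ) (x : X k) (n : ℕ) :
    (coherentOf i k x).1 n = transition i k n x := rfl

/-- The inductive limit, in the category of Banach spaces with an isometric action, of a sequence of
separable spaces. -/
theorem ActedSpace.exists_limit {Γ : Type w} [Group Γ] [TopologicalSpace Γ]
    (X : ℕ → ActedSpace.{v, w} Γ) (i : ∀ n, (X n).carrier →ₗᵢ[ℝ] (X (n + 1)).carrier)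
    (hi : ∀ n γ x, (X (n + 1)).act γ (i n x) = i n ((X n).act γ x)) :
    ∃ (Y : ActedSpace.{v, w} Γ) (j : ∀ n, (X n).carrier →ₗᵢ[ℝ] Y.carrier),
      CompleteSpace Y.carrier ∧ (∀ n γ x, Y.act γ (j n x) = j n ((X n).act γ x)) ∧
      (∀ n x, j (n + 1) (i n x) = j n x) ∧
      ∀ y, ∀ ε > 0, ∃ n x, ‖y - j n x‖ < ε := by
  let D := coherentSubmodule i
  let N := coherentSeminorm i
  let ρ : Γ →* (D →ₗ[ℝ] D) :=
    { toFun := fun γ => LinearMap.codRestrict _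
        ((LinearMap.pi fun n => ((X n).act γ).toLinearMap ∘ₗ LinearMap.proj n) ∘ₗ D.subtype)
        fun d => d.2.mono fun n hn => by
          change (X (n + 1)).act γ (d.1 (n + 1)) = i n ((X n).act γ (d.1 n))
          rw [hn, hi]
      map_one' := by
        ext d n
        change (X n).act 1 (d.1 n) = d.1 n
        rw [map_one]; rfl
      map_mul' := fun γ γ' => by
        ext d n
        change (X n).act (γ * γ') (d.1 n) = (X n).act γ ((X n).act γ' (d.1 n))
        rw [map_mul]; rfl }
  have hρ : ∀ γ d n, (ρ γ d).1 n = (X n).act γ (d.1 n) := fun γ d n => rfl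
  obtain ⟨Y, _, _, _, q, σ, hq, hd, hσ⟩ := N.exists_completion_action ρ (fun γ d => by
    refine tendsto_nhds_unique (tendsto_norm_coherentSubmodule i (ρ γ d))
      ((tendsto_norm_coherentSubmodule i d).congr fun n => ?_)
    rw [hρ, LinearIsometry.norm_map])
  -- sequences that eventually agree have the same image under `q`
  have hqeq : ∀ d d' : D, (∀ᶠ n in Filter.atTop, d.1 n = d'.1 n) → q d = q d' := fun d d' h => by
    rw [← sub_eq_zero, ← map_sub, ← norm_eq_zero, hq]
    refine coherentSeminorm_eq i (h.mono fun n hn => ?_)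
    change ‖d.1 n - d'.1 n‖ = 0
    rw [hn, sub_self, norm_zero]
  let j : ∀ n, (X n).carrier →ₗᵢ[ℝ] Y := fun n =>
    { toLinearMap := q ∘ₗ coherentOf i n
      norm_map' := fun x => by
        change ‖q (coherentOf i n x)‖ = ‖x‖
        rw [hq]
        exact coherentSeminorm_eq i (Filter.eventually_atTop.2
          ⟨n, fun m hm => norm_transition i hm x⟩) }
  have hj : ∀ n x, j n x = q (coherentOf i n x) := fun n x => rfl
  have hjσ : ∀ n γ x, σ γ (j n x) = j n ((X n).act γ x) := fun n γ x => by
    rw [hj, hσ, hj]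
    refine hqeq _ _ (Filter.eventually_atTop.2 ⟨n, fun m hm => ?_⟩)
    rw [hρ, coherentOf_apply, coherentOf_apply,
      transition_equivariant i (A := fun n => (X n).act γ) (fun n x => hi n γ x) hm]
  have hrange : ∀ d : D, ∃ n x, q d = j n x := fun d => by
    obtain ⟨k, hk⟩ := exists_transition_eq_of_mem_coherentSubmodule i d.2
    refine ⟨k, d.1 k, hqeq _ _ (Filter.eventually_atTop.2 ⟨k, fun m hm => ?_⟩)⟩
    rw [coherentOf_apply, hk m hm]
  have hclosure : ∀ y, y ∈ closure (⋃ n, Set.range (j n)) := fun y => by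
    refine closure_mono ?_ (hd y)
    rintro _ ⟨d, rfl⟩
    obtain ⟨n, x, hx⟩ := hrange d
    exact Set.mem_iUnion.2 ⟨n, x, hx.symm⟩
  have hsep : TopologicalSpace.SeparableSpace Y := by
    rw [← TopologicalSpace.isSeparable_univ_iff]
    exact ((TopologicalSpace.IsSeparable.iUnion fun n =>
      TopologicalSpace.isSeparable_range (j n).continuous).closure).mono fun y _ => hclosure y
  refine ⟨{ carrier := Y, act := σ, continuous_act := fun y =>
      continuous_orbit_of_mem_closure (fun γ => σ γ) ?_ (hclosure y) }, j, inferInstance, hjσ, ?_, ?_⟩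
  · intro y hy
    obtain ⟨n, x, rfl⟩ := Set.mem_iUnion.1 hy
    simp only [hjσ]
    exact (j n).continuous.comp ((X n).continuous_act x)
  · intro n x
    refine hqeq _ _ (Filter.eventually_atTop.2 ⟨n + 1, fun m hm => ?_⟩)
    rw [coherentOf_apply, coherentOf_apply, transition_succ_left i hm]
  · intro y ε hε
    obtain ⟨z, hz, hyz⟩ := Metric.mem_closure_iff.1 (hclosure y) ε hε
    obtain ⟨n, x, rfl⟩ := Set.mem_iUnion.1 hz
    exact ⟨n, x, by rwa [← dist_eq_norm]⟩

end Limit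

/-! ### The equivariant tower -/

section Step

/-- Precomposition with a linear isometry, as a map of dual balls. -/
noncomputable def DualBall.precomp {X : Type u} [NormedAddCommGroup X] [NormedSpace ℝ X]
    (T : X →ₗᵢ[ℝ] X) (l : DualBall X) : DualBall X :=
  DualBall.mk (l.1.toLinearMap ∘ₗ T.toLinearMap) fun x =>
    (l.abs_apply_le (T x)).trans_eq (T.norm_map x)

variable {Γ : Type w} [Group Γ] [TopologicalSpace Γ]

theorem ActedSpace.continuous_precomp (X : ActedSpace.{v, w} Γ) :
    Continuous fun q : Γ × (DualBall X.carrier × unitInterval) =>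
      (q.2.1.precomp (X.act q.1), q.2.2) := by
  refine Continuous.prodMk (DualBall.continuous_of_apply fun x => ?_)
    (continuous_snd.comp continuous_snd)
  exact DualBall.continuous_eval.comp ((continuous_fst.comp continuous_snd).prodMk
    ((X.continuous_act x).comp continuous_fst))

/-- The action of a group element on `DualBall X × [0, 1]`. -/
noncomputable def ActedSpace.precompMap (X : ActedSpace.{v, w} Γ) (γ : Γ) :
    C(DualBall X.carrier × unitInterval, DualBall X.carrier × unitInterval) :=
  ⟨fun q => (q.1.precomp (X.act γ), q.2),
    X.continuous_precomp.comp (continuous_const.prodMk continuous_id)⟩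

theorem ActedSpace.precompMap_apply (X : ActedSpace.{v, w} Γ) (γ : Γ)
    (q : DualBall X.carrier × unitInterval) :
    X.precompMap γ q = (q.1.precomp (X.act γ), q.2) := rfl

theorem ActedSpace.precompMap_one (X : ActedSpace.{v, w} Γ) (q) : X.precompMap 1 q = q := by
  rw [precompMap_apply, map_one]; rfl

theorem ActedSpace.precompMap_mul (X : ActedSpace.{v, w} Γ) (γ γ' : Γ) (q) :
    X.precompMap (γ * γ') q = X.precompMap γ' (X.precompMap γ q) := by
  simp only [precompMap_apply, map_mul]; rfl

/-- The action of `Γ` on `DualBallMaps X` induced by an action on `X`. Precomposition reverses the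
order twice, once on functionals and once on functions of functionals, so this is a left action. -/
noncomputable def ActedSpace.step (X : ActedSpace.{v, w} Γ) : ActedSpace.{v, w} Γ where
  carrier := DualBallMaps X.carrier
  act :=
    { toFun := fun γ =>
        { toFun := fun f => f.comp (X.precompMap γ)
          map_add' := fun f g => rfl
          map_smul' := fun t f => rfl
          norm_map' := fun f => by
            refine le_antisymm ((ContinuousMap.norm_le _ (norm_nonneg f)).2 fun q =>
              f.norm_coe_le_norm _) ((ContinuousMap.norm_le _ (norm_nonneg _)).2 fun q => ?_)
            have h := (f.comp (X.precompMap γ)).norm_coe_le_norm (X.precompMap γ⁻¹ q)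
            rwa [ContinuousMap.comp_apply, ← precompMap_mul, inv_mul_cancel, precompMap_one] at h }
      map_one' := by
        ext f q
        exact congrArg f (X.precompMap_one q)
      map_mul' := fun γ γ' => by
        ext f q
        exact congrArg f (X.precompMap_mul γ γ' q) }
  continuous_act f := (ContinuousMap.curry ⟨fun q : Γ × (DualBall X.carrier × unitInterval) =>
    f (q.2.1.precomp (X.act q.1), q.2.2), f.continuous.comp X.continuous_precomp⟩).continuous

theorem ActedSpace.step_act_dualBallEval (X : ActedSpace.{v, w} Γ) (γ : Γ) (x : X.carrier) :
    X.step.act γ (dualBallEval X.carrier x) = dualBallEval X.carrier (X.act γ x) := rfl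

/-- The iterates of `ActedSpace.step`. -/
noncomputable def ActedSpace.tower (X : ActedSpace.{v, w} Γ) : ℕ → ActedSpace.{v, w} Γ
  | 0 => X
  | n + 1 => (X.tower n).step

end Step

/-! ### The limit space is a Gurarij space -/

section Criterion

variable {Y : Type v} [NormedAddCommGroup Y] [NormedSpace ℝ Y]

/-- Linear maps from a finite-dimensional space to a limit space factor, up to a small error,
through one of the approximating spaces. -/
theorem exists_linearMap_near {X : ℕ → Type u} [∀ n, NormedAddCommGroup (X n)]
    [∀ n, NormedSpace ℝ (X n)] (j : ∀ n, X n →ₗᵢ[ℝ] Y)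
    (hmono : ∀ n x, ∃ x', j (n + 1) x' = j n x) (hdense : ∀ y, ∀ ε > 0, ∃ n x, ‖y - j n x‖ < ε)
    {F : Type w} [NormedAddCommGroup F] [NormedSpace ℝ F] [FiniteDimensional ℝ F]
    (ψ : F →ₗ[ℝ] Y) {η : ℝ} (hη : 0 < η) :
    ∃ (n : ℕ) (ψ' : F →ₗ[ℝ] X n), ∀ x, ‖j n (ψ' x) - ψ x‖ ≤ η * ‖x‖ := by
  have hmono' : ∀ m n, m ≤ n → ∀ x, ∃ x', j n x' = j m x := by
    intro m n hmn
    induction n, hmn using Nat.le_induction with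
    | base => exact fun x => ⟨x, rfl⟩
    | succ n _ ih =>
      intro x
      obtain ⟨x', hx'⟩ := ih x
      obtain ⟨x'', hx''⟩ := hmono n x'
      exact ⟨x'', hx''.trans hx'⟩
  let b := Module.finBasis ℝ F
  let c : Fin (Module.finrank ℝ F) → StrongDual ℝ F := fun i => (b.coord i).toContinuousLinearMap
  have hc : ∀ i x, c i x = b.repr x i := fun i x => rfl
  set C := ∑ i, ‖c i‖ with hC
  have hC0 : 0 ≤ C := Finset.sum_nonneg fun i _ => norm_nonneg _
  choose n x hx using fun i => hdense (ψ (b i)) (η / (C + 1)) (by positivity)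
  obtain ⟨N, hN⟩ : ∃ N, ∀ i, n i ≤ N :=
    ⟨Finset.univ.sup n, fun i => Finset.le_sup (Finset.mem_univ i)⟩
  choose x' hx' using fun i => hmono' (n i) N (hN i) (x i)
  refine ⟨N, b.constr ℝ x', fun z => ?_⟩
  have h1 : j N (b.constr ℝ x' z) - ψ z = ∑ i, c i z • (j N (x' i) - ψ (b i)) := by
    conv_lhs => rw [← b.sum_repr z]
    simp only [map_sum, map_smul, b.constr_basis, smul_sub, Finset.sum_sub_distrib, hc]
  rw [h1]
  calc ‖∑ i, c i z • (j N (x' i) - ψ (b i))‖ ≤ ∑ i, ‖c i‖ * ‖z‖ * (η / (C + 1)) := by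
        refine (norm_sum_le _ _).trans (Finset.sum_le_sum fun i _ => ?_)
        rw [norm_smul, hx', norm_sub_rev]
        exact mul_le_mul ((c i).le_opNorm z) (hx i).le (norm_nonneg _) (by positivity)
    _ = C / (C + 1) * (η * ‖z‖) := by
        rw [← Finset.sum_mul, ← Finset.sum_mul, ← hC]; ring
    _ ≤ η * ‖z‖ := by
        refine mul_le_of_le_one_left (by positivity) ?_
        rw [div_le_one (by positivity)]; linarith

/-- One-dimensional extensions up to arbitrarily small errors suffice for a Gurarij space: the
errors made in adding finitely many vectors one at a time add up. -/
theorem IsGurarij.of_one_vector_extension [CompleteSpace Y] [TopologicalSpace.SeparableSpace Y]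
    (h : ∀ (F : Type) [NormedAddCommGroup F] [NormedSpace ℝ F] [FiniteDimensional ℝ F]
      (E : Submodule ℝ F) (ψ : F →ₗ[ℝ] Y) (δ : ℝ), 0 ≤ δ → (∀ x ∈ E, |‖ψ x‖ - ‖x‖| ≤ δ * ‖x‖) →
      ∀ (v : F) (ε : ℝ), 0 < ε → ∃ ψ' : F →ₗ[ℝ] Y, (∀ x ∈ E, ψ' x = ψ x) ∧
        ∀ x ∈ E ⊔ Submodule.span ℝ {v}, |‖ψ' x‖ - ‖x‖| ≤ (δ + ε) * ‖x‖) :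
    IsGurarij Y := by
  refine ⟨inferInstance, inferInstance, fun ε hε F _ _ _ E ψ => ?_⟩
  obtain ⟨ψ₀, hψ₀⟩ := ψ.toLinearMap.exists_extend
  have hψ₀' : ∀ x : E, ψ₀ x = ψ x := fun x => LinearMap.congr_fun hψ₀ x
  have key : ∀ s : Finset F, ∀ ε : ℝ, 0 < ε → ∃ φ : F →ₗ[ℝ] Y, (∀ x ∈ E, φ x = ψ₀ x) ∧
      ∀ x ∈ E ⊔ Submodule.span ℝ (s : Set F), |‖φ x‖ - ‖x‖| ≤ ε * ‖x‖ := by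
    classical
    intro s
    induction s using Finset.induction_on with
    | empty =>
      intro ε hε
      refine ⟨ψ₀, fun x _ => rfl, fun x hx => ?_⟩
      have hx' : x ∈ E := by simpa using hx
      have h1 : ‖ψ₀ x‖ = ‖x‖ := by rw [hψ₀' ⟨x, hx'⟩, ψ.norm_map]; rfl
      rw [h1, sub_self, abs_zero]
      positivity
    | insert v s _ ih =>
      intro ε hε
      obtain ⟨φ, h1, h2⟩ := ih (ε / 2) (by positivity)
      obtain ⟨φ', h3, h4⟩ := h F _ φ (ε / 2) (by positivity) h2 v (ε / 2) (by positivity)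
      refine ⟨φ', fun x hx => (h3 x (Submodule.mem_sup_left hx)).trans (h1 x hx), fun x hx => ?_⟩
      rw [add_halves] at h4
      refine h4 x ?_
      rwa [Finset.coe_insert, Submodule.span_insert, sup_comm (Submodule.span ℝ {v}), ← sup_assoc]
        at hx
  obtain ⟨s, hs⟩ := (Module.Finite.fg_top : (⊤ : Submodule ℝ F).FG)
  obtain ⟨φ, h1, h2⟩ := key s (min ε (1 / 2)) (by positivity)
  rw [hs, sup_top_eq] at h2
  have h3 : ∀ x, |‖φ x‖ - ‖x‖| ≤ min ε (1 / 2) * ‖x‖ := fun x => h2 x Submodule.mem_top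
  refine ⟨φ, (injective_iff_map_eq_zero φ).2 fun x hx => ?_, fun x => (h1 x x.2).trans (hψ₀' x),
    fun x => ?_⟩
  · have h4 := (abs_le.1 (h3 x)).1
    have h5 := mul_le_mul_of_nonneg_right (min_le_right ε (1 / 2)) (norm_nonneg x)
    rw [hx, norm_zero] at h4
    have h6 : ‖x‖ ≤ 0 := by linarith
    exact norm_le_zero_iff.1 h6
  · have h4 := abs_le.1 ((h3 x).trans
      (mul_le_mul_of_nonneg_right (min_le_left ε (1 / 2)) (norm_nonneg x)))
    constructor <;> linarith

/-- A limit of spaces such that one-dimensional extensions of finite-dimensional pieces of each of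
them are almost realised in the limit is a Gurarij space. -/
theorem IsGurarij.of_limit [CompleteSpace Y] [TopologicalSpace.SeparableSpace Y]
    {X : ℕ → Type u} [∀ n, NormedAddCommGroup (X n)] [∀ n, NormedSpace ℝ (X n)]
    (j : ∀ n, X n →ₗᵢ[ℝ] Y) (hmono : ∀ n x, ∃ x', j (n + 1) x' = j n x)
    (hdense : ∀ y, ∀ ε > 0, ∃ n x, ‖y - j n x‖ < ε)
    (h : ∀ (n : ℕ) (F : Type) [NormedAddCommGroup F] [NormedSpace ℝ F] [FiniteDimensional ℝ F]
      (E : Submodule ℝ F) (ψ : F →ₗ[ℝ] X n) (δ : ℝ), 0 ≤ δ → (∀ x ∈ E, |‖ψ x‖ - ‖x‖| ≤ δ * ‖x‖) →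
      ∀ (v : F) (ε : ℝ), 0 < ε → ∃ g : Y, ∀ x ∈ E, ∀ t : ℝ,
        |‖j n (ψ x) + t • g‖ - ‖x + t • v‖| ≤ δ * ‖x + t • v‖ + ε * ‖x‖) :
    IsGurarij Y := by
  refine IsGurarij.of_one_vector_extension fun F _ _ _ E ψ δ hδ hψ v ε hε => ?_
  by_cases hv : v ∈ E
  · refine ⟨ψ, fun x _ => rfl, fun x hx => ?_⟩
    rw [sup_eq_left.2 ((Submodule.span_singleton_le_iff_mem v E).2 hv)] at hx
    refine (hψ x hx).trans (mul_le_mul_of_nonneg_right ?_ (norm_nonneg x))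
    linarith
  obtain ⟨f₀, hf₀v, hf₀E⟩ := Submodule.exists_le_ker_of_notMem hv
  let f : F →ₗ[ℝ] ℝ := (f₀ v)⁻¹ • f₀
  have hfv : f v = 1 := inv_mul_cancel₀ hf₀v
  have hfE : ∀ x ∈ E, f x = 0 := fun x hx => by
    have : f₀ x = 0 := hf₀E hx
    simp [f, this]
  set M : ℝ := 1 + ‖f.toContinuousLinearMap‖ * ‖v‖ with hM
  have hM0 : 0 < M := by positivity
  -- `M` bounds the projection to `E` along `v`; an error `η` on `E` costs at most `(1 + 2 * M) * η`
  set η : ℝ := ε / (1 + 2 * M) with hη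
  have hη0 : 0 < η := by positivity
  obtain ⟨n, ψ', hψ'⟩ := exists_linearMap_near j hmono hdense ψ hη0
  obtain ⟨g, hg⟩ := h n F E ψ' (δ + η) (by positivity) (fun x hx => by
    have h1 := hψ x hx
    have h2 := (abs_norm_sub_norm_le (j n (ψ' x)) (ψ x)).trans (hψ' x)
    rw [LinearIsometry.norm_map] at h2
    rw [abs_le] at h1 h2 ⊢
    constructor <;> linarith) v η hη0
  refine ⟨ψ + f.smulRight (g - ψ v), fun x hx => by simp [hfE x hx], fun z hz => ?_⟩
  obtain ⟨x, hx, y, hy, rfl⟩ := Submodule.mem_sup.1 hz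
  obtain ⟨t, rfl⟩ := Submodule.mem_span_singleton.1 hy
  have hft : f (x + t • v) = t := by rw [map_add, map_smul, hfE x hx, hfv]; simp
  have h1 : (ψ + f.smulRight (g - ψ v)) (x + t • v) = ψ x + t • g := by
    rw [LinearMap.add_apply, LinearMap.smulRight_apply, hft, map_add, map_smul, smul_sub]; abel
  have h2 : ‖x‖ ≤ M * ‖x + t • v‖ := by
    have h3 : |t| ≤ ‖f.toContinuousLinearMap‖ * ‖x + t • v‖ := by
      have := f.toContinuousLinearMap.le_opNorm (x + t • v)
      rwa [LinearMap.coe_toContinuousLinearMap', hft, Real.norm_eq_abs] at this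
    have h4 := norm_sub_le (x + t • v) (t • v)
    rw [add_sub_cancel_right, norm_smul, Real.norm_eq_abs] at h4
    have h5 := mul_le_mul_of_nonneg_right h3 (norm_nonneg v)
    rw [hM]; linarith
  have h3 := hg x hx t
  have h4 := abs_norm_sub_norm_le (j n (ψ' x) + t • g) (ψ x + t • g)
  rw [add_sub_add_right_eq_sub] at h4
  have h5 := h4.trans (hψ' x)
  have h6 := mul_le_mul_of_nonneg_left h2 hη0.le
  have h7 : ε = η * (1 + 2 * M) := by rw [hη]; field_simp
  rw [h1, h7]
  rw [abs_le] at h3 h5 ⊢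
  constructor <;> linarith

end Criterion

/-- Every separable space with an action embeds equivariantly in a Gurarij space with an action. -/
theorem ActedSpace.exists_gurarij {Γ : Type w} [Group Γ] [TopologicalSpace Γ]
    (X : ActedSpace.{v, w} Γ) :
    ∃ (Y : ActedSpace.{v, w} Γ) (j : X.carrier →ₗᵢ[ℝ] Y.carrier), IsGurarij Y.carrier ∧
      ∀ γ x, Y.act γ (j x) = j (X.act γ x) := by
  let i : ∀ n, (X.tower n).carrier →ₗᵢ[ℝ] (X.tower (n + 1)).carrier := fun n =>
    dualBallEval (X.tower n).carrier
  obtain ⟨Y, j, _, hj, hij, hd⟩ := ActedSpace.exists_limit X.tower i fun n γ x =>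
    (X.tower n).step_act_dualBallEval γ x
  refine ⟨Y, j 0, ?_, hj 0⟩
  refine IsGurarij.of_limit j (fun n x => ⟨i n x, hij n x⟩) hd
    fun n F _ _ _ E ψ δ hδ hψ v ε hε => ?_
  obtain ⟨g, hg⟩ := exists_dualBallMaps_realising E ψ hδ hψ v hε
  let g' : (X.tower (n + 1)).carrier := g
  refine ⟨j (n + 1) g', fun x hx t => ?_⟩
  have h1 : j n (ψ x) + t • j (n + 1) g' = j (n + 1) (i n (ψ x) + t • g') := by
    rw [map_add, map_smul, hij]
  rw [h1, LinearIsometry.norm_map]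
  exact hg x hx t

/-! ### The topological group of linear isometries -/

theorem DenseRange.exists_isometry_extension {ι : Type*} {X : Type u} {Y : Type v} [MetricSpace X]
    [MetricSpace Y] [CompleteSpace Y] {D : ι → X} (hD : DenseRange D) {c : ι → Y}
    (hc : ∀ m n, dist (c m) (c n) = dist (D m) (D n)) :
    ∃ f : X → Y, Isometry f ∧ ∀ n, f (D n) = c n := by
  let : PseudoMetricSpace ι := PseudoMetricSpace.induced D inferInstance
  have hDi : Isometry D := Isometry.of_dist_eq fun _ _ => rfl
  have hci : Isometry c := Isometry.of_dist_eq hc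
  let f := (hDi.isUniformInducing.isDenseInducing hD).extend c
  have hf : Continuous f := (uniformContinuous_uniformly_extend hDi.isUniformInducing hD
    hci.uniformContinuous).continuous
  have hfD : ∀ n, f (D n) = c n := fun n =>
    (hDi.isUniformInducing.isDenseInducing hD).extend_eq hci.continuous n
  refine ⟨f, Isometry.of_dist_eq fun x y => ?_, hfD⟩
  refine hD.induction_on₂ (p := fun x y => dist (f x) (f y) = dist x y)
    (isClosed_eq ((hf.comp continuous_fst).dist (hf.comp continuous_snd))
      (continuous_fst.dist continuous_snd)) (fun m n => ?_) x y
  rw [hfD, hfD, hc]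

section IsometryGroup

variable {E : Type u} [NormedAddCommGroup E] [NormedSpace ℝ E]

theorem LinearIsometryEquiv.continuous_iff_apply {T : Type*} [TopologicalSpace T]
    {f : T → (E ≃ₗᵢ[ℝ] E)} : Continuous f ↔ ∀ x, Continuous fun t => f t x :=
  continuous_induced_rng.trans continuous_pi_iff

theorem LinearIsometryEquiv.tendsto_iff_apply {T : Type*} {l : Filter T} {f : T → (E ≃ₗᵢ[ℝ] E)}
    {φ : E ≃ₗᵢ[ℝ] E} :
    Filter.Tendsto f l (𝓝 φ) ↔ ∀ x, Filter.Tendsto (fun t => f t x) l (𝓝 (φ x)) := by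
  rw [nhds_induced, Filter.tendsto_comap_iff, tendsto_pi_nhds]; rfl

theorem LinearIsometryEquiv.continuous_eval_const (x : E) : Continuous fun φ : E ≃ₗᵢ[ℝ] E => φ x :=
  LinearIsometryEquiv.continuous_iff_apply.1 continuous_id x

theorem LinearIsometryEquiv.continuous_eval :
    Continuous fun q : (E ≃ₗᵢ[ℝ] E) × E => q.1 q.2 := by
  refine continuous_iff_continuousAt.2 fun ⟨φ, x⟩ => ?_
  rw [ContinuousAt, tendsto_iff_dist_tendsto_zero]
  have h1 : Continuous fun q : (E ≃ₗᵢ[ℝ] E) × E => dist q.2 x + dist (q.1 x) (φ x) :=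
    (continuous_snd.dist continuous_const).add
      (((LinearIsometryEquiv.continuous_eval_const x).comp continuous_fst).dist continuous_const)
  refine squeeze_zero (fun _ => dist_nonneg) (fun q => ?_)
    (by simpa using h1.tendsto (φ, x) :
      Filter.Tendsto (fun q : (E ≃ₗᵢ[ℝ] E) × E => dist q.2 x + dist (q.1 x) (φ x)) (𝓝 (φ, x)) (𝓝 0))
  refine (dist_triangle _ (q.1 x) _).trans (le_of_eq ?_)
  rw [q.1.dist_map]

instance LinearIsometryEquiv.isTopologicalGroup_pointwise : IsTopologicalGroup (E ≃ₗᵢ[ℝ] E) where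
  continuous_mul := LinearIsometryEquiv.continuous_iff_apply.2 fun x =>
    LinearIsometryEquiv.continuous_eval.comp
      (continuous_fst.prodMk ((LinearIsometryEquiv.continuous_eval_const x).comp continuous_snd))
  continuous_inv := LinearIsometryEquiv.continuous_iff_apply.2 fun x => by
    refine continuous_iff_continuousAt.2 fun φ => ?_
    rw [ContinuousAt, tendsto_iff_dist_tendsto_zero]
    have h1 : Continuous fun ψ : E ≃ₗᵢ[ℝ] E => dist x (ψ (φ⁻¹ x)) :=
      continuous_const.dist (LinearIsometryEquiv.continuous_eval_const _)
    have h2 := h1.tendsto φ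
    have h3 : φ (φ⁻¹ x) = x := φ.apply_symm_apply x
    rw [h3, dist_self] at h2
    refine h2.congr fun ψ => ?_
    rw [← ψ.dist_map (ψ⁻¹ x)]
    congr 1
    exact (ψ.apply_symm_apply x).symm

variable (E) in
/-- The linear isometry group of a separable Banach space is Polish: evaluating an isometry and its
inverse along a dense sequence is a closed embedding. By the Mazur–Ulam theorem, linearity of the
limit need not be looked after. -/
theorem LinearIsometryEquiv.polishSpace [CompleteSpace E] [TopologicalSpace.SeparableSpace E] :
    PolishSpace (E ≃ₗᵢ[ℝ] E) := by
  -- `D` starts with `0`, so that maps fixing `D 0` are eligible for the Mazur–Ulam theorem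
  let D : ℕ → E := fun n => Nat.casesOn n 0 (TopologicalSpace.denseSeq E)
  have hD0 : D 0 = 0 := rfl
  have hD : DenseRange D := (TopologicalSpace.denseRange_denseSeq E).mono (by
    rintro _ ⟨n, rfl⟩; exact ⟨n + 1, rfl⟩)
  let Φ : (E ≃ₗᵢ[ℝ] E) → (ℕ → E) × (ℕ → E) := fun φ => (fun n => φ (D n), fun n => φ⁻¹ (D n))
  have hΦc : Continuous Φ := by
    refine Continuous.prodMk ?_ ?_
    · exact continuous_pi fun n => LinearIsometryEquiv.continuous_eval_const (D n)
    · exact continuous_pi fun n => (LinearIsometryEquiv.continuous_eval_const (D n)).comp continuous_inv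
  -- a family of isometries converging on the range of `D` converges pointwise
  have hΦi : IsInducing Φ := by
    refine isInducing_iff_nhds.2 fun φ => le_antisymm (hΦc.tendsto φ).le_comap ?_
    rw [← Filter.tendsto_id', LinearIsometryEquiv.tendsto_iff_apply]
    intro x
    rw [Metric.tendsto_nhds]
    intro ε hε
    obtain ⟨n, hn⟩ := hD.exists_dist_lt x (show 0 < ε / 3 by positivity)
    have h1 : Filter.Tendsto (fun ψ : E ≃ₗᵢ[ℝ] E => ψ (D n)) (Filter.comap Φ (𝓝 (Φ φ)))
        (𝓝 (φ (D n))) :=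
      (((_root_.continuous_apply n).comp continuous_fst).tendsto (Φ φ)).comp Filter.tendsto_comap
    filter_upwards [Metric.tendsto_nhds.1 h1 (ε / 3) (by positivity)] with ψ hψ
    have h2 := dist_triangle4 (ψ x) (ψ (D n)) (φ (D n)) (φ x)
    rw [ψ.dist_map, φ.dist_map, dist_comm (D n) x] at h2
    rw [id]
    linarith
  -- the last distance equation says that the extensions of `a` and `b` are inverse to each other
  have hrange : Set.range Φ = {q | (∀ m n, dist (q.1 m) (q.1 n) = dist (D m) (D n)) ∧
      (∀ m n, dist (q.2 m) (q.2 n) = dist (D m) (D n)) ∧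
      (∀ m n, dist (q.1 m) (D n) = dist (D m) (q.2 n)) ∧ q.1 0 = 0} := by
    ext ⟨a, b⟩
    constructor
    · rintro ⟨φ, hφ⟩
      obtain ⟨rfl, rfl⟩ := Prod.ext_iff.1 hφ
      refine ⟨fun m n => φ.dist_map _ _, fun m n => φ⁻¹.dist_map _ _, fun m n => ?_, ?_⟩
      · change dist (φ (D m)) (D n) = dist (D m) (φ⁻¹ (D n))
        rw [← φ.dist_map (D m)]
        congr 1
        exact (φ.apply_symm_apply (D n)).symm
      · exact map_zero φ
    · rintro ⟨ha, hb, hab, h0⟩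
      obtain ⟨f, hf, hfa⟩ := hD.exists_isometry_extension ha
      obtain ⟨g, hg, hgb⟩ := hD.exists_isometry_extension hb
      have hfg : ∀ x y, dist (f x) y = dist x (g y) := by
        intro x y
        refine hD.induction_on₂ (p := fun x y => dist (f x) y = dist x (g y))
          (isClosed_eq ((hf.continuous.comp continuous_fst).dist continuous_snd)
            (continuous_fst.dist (hg.continuous.comp continuous_snd))) (fun m n => ?_) x y
        rw [hfa, hgb, hab]
      let e : E ≃ᵢ E := IsometryEquiv.mk' f g (fun y => dist_eq_zero.1 (by rw [hfg, dist_self])) hf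
      have he0 : e 0 = 0 := by
        change f 0 = 0
        rw [← hD0, hfa]
        exact h0
      refine ⟨e.toRealLinearIsometryEquivOfMapZero he0, Prod.ext (funext hfa) (funext hgb)⟩
  have hclosed : IsClosed (Set.range Φ) := by
    rw [hrange]
    have c1 : ∀ n, Continuous fun q : (ℕ → E) × (ℕ → E) => q.1 n := fun n =>
      (_root_.continuous_apply n).comp continuous_fst
    have c2 : ∀ n, Continuous fun q : (ℕ → E) × (ℕ → E) => q.2 n := fun n =>
      (_root_.continuous_apply n).comp continuous_snd
    have k1 : IsClosed {q : (ℕ → E) × (ℕ → E) | ∀ m n, dist (q.1 m) (q.1 n) = dist (D m) (D n)} := by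
      simp only [Set.ofPred_forall]
      exact isClosed_iInter fun m => isClosed_iInter fun n =>
        isClosed_eq ((c1 m).dist (c1 n)) continuous_const
    have k2 : IsClosed {q : (ℕ → E) × (ℕ → E) | ∀ m n, dist (q.2 m) (q.2 n) = dist (D m) (D n)} := by
      simp only [Set.ofPred_forall]
      exact isClosed_iInter fun m => isClosed_iInter fun n =>
        isClosed_eq ((c2 m).dist (c2 n)) continuous_const
    have k3 : IsClosed {q : (ℕ → E) × (ℕ → E) | ∀ m n, dist (q.1 m) (D n) = dist (D m) (q.2 n)} := by
      simp only [Set.ofPred_forall]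
      exact isClosed_iInter fun m => isClosed_iInter fun n =>
        isClosed_eq ((c1 m).dist continuous_const) (continuous_const.dist (c2 n))
    exact k1.inter (k2.inter (k3.inter (isClosed_eq (c1 0) continuous_const)))
  have hinj : Function.Injective Φ := fun φ ψ h => DFunLike.coe_injective
    (φ.continuous.ext_on hD ψ.continuous (Set.eqOn_range.2 (Prod.ext_iff.1 h).1))
  exact (IsClosedEmbedding.mk (IsEmbedding.mk hΦi hinj) hclosed).polishSpace

end IsometryGroup

/-! ### Equivariant embeddings in a Gurarij space -/

section Equivariant

/-- An action of a group by linear isometries is an action by invertible linear isometries. -/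
noncomputable def LinearIsometry.toEquivHom {Γ : Type w} [Group Γ] {Y : Type u}
    [NormedAddCommGroup Y] [NormedSpace ℝ Y] (σ : Γ →* (Y →ₗᵢ[ℝ] Y)) : Γ →* (Y ≃ₗᵢ[ℝ] Y) where
  toFun γ := LinearIsometryEquiv.ofSurjective (σ γ) fun y => ⟨σ γ⁻¹ y, by
    have h := congrArg (· y) (map_mul σ γ γ⁻¹)
    rw [mul_inv_cancel, map_one] at h
    exact h.symm⟩
  map_one' := by ext y; exact congrArg (· y) (map_one σ)
  map_mul' γ γ' := by ext y; exact congrArg (· y) (map_mul σ γ γ')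

/-- Restriction of an isometric action to an invariant subspace, which is given as the range of an
isometric embedding. -/
theorem LinearIsometry.exists_restrict_action {Γ : Type w} [Group Γ] {B : Type u} {E : Type v}
    [NormedAddCommGroup B] [NormedSpace ℝ B] [NormedAddCommGroup E] [NormedSpace ℝ E]
    (A : Γ →* (B →ₗᵢ[ℝ] B)) (i : E →ₗᵢ[ℝ] B) (h : ∀ γ x, ∃ y, i y = A γ (i x)) :
    ∃ σ : Γ →* (E ≃ₗᵢ[ℝ] E), ∀ γ x, i (σ γ x) = A γ (i x) := by
  choose s hs using h
  let σ : Γ →* (E →ₗᵢ[ℝ] E) :=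
    { toFun := fun γ =>
        { toFun := s γ
          map_add' := fun x y => i.injective (by simp only [hs, map_add])
          map_smul' := fun c x => i.injective (by simp only [hs, map_smul, RingHom.id_apply])
          norm_map' := fun x => by
            change ‖s γ x‖ = ‖x‖
            rw [← i.norm_map, hs, LinearIsometry.norm_map, LinearIsometry.norm_map] }
      map_one' := by
        ext x
        refine i.injective ((hs 1 x).trans ?_)
        rw [map_one]; rfl
      map_mul' := fun γ γ' => by
        ext x
        refine i.injective ((hs (γ * γ') x).trans ?_)
        change _ = i (s γ (s γ' x))
        rw [hs, hs, map_mul]; rfl }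
  exact ⟨LinearIsometry.toEquivHom σ, hs⟩

variable {G : Type u} [NormedAddCommGroup G] [NormedSpace ℝ G]
  {E : Type v} [NormedAddCommGroup E] [NormedSpace ℝ E]

/-- A separable normed space has a linear isometric embedding in any Gurarij space along which
linear isometries extend by a continuous homomorphism. -/
theorem IsGurarij.exists_equivariant_embedding (hG : IsGurarij G)
    [TopologicalSpace.SeparableSpace E] :
    ∃ (ι : E →ₗᵢ[ℝ] G) (Θ : (E ≃ₗᵢ[ℝ] E) →* (G ≃ₗᵢ[ℝ] G)), Continuous Θ ∧
      ∀ φ x, Θ φ (ι x) = ι (φ x) := by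
  let X : ActedSpace (E ≃ₗᵢ[ℝ] E) :=
    { carrier := E
      act :=
        { toFun := fun φ => φ.toLinearIsometry
          map_one' := rfl
          map_mul' := fun _ _ => rfl }
      continuous_act := LinearIsometryEquiv.continuous_eval_const }
  obtain ⟨Y, j, hY, hj⟩ := X.exists_gurarij
  obtain ⟨e⟩ := hY.nonempty_linearIsometryEquiv hG
  let σ : (E ≃ₗᵢ[ℝ] E) →* (G →ₗᵢ[ℝ] G) :=
    { toFun := fun φ => e.toLinearIsometry.comp ((Y.act φ).comp e.symm.toLinearIsometry)
      map_one' := by ext y; simp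
      map_mul' := fun φ ψ => by ext y; simp }
  have hσ : ∀ φ y, σ φ y = e (Y.act φ (e.symm y)) := fun φ y => rfl
  refine ⟨e.toLinearIsometry.comp j, LinearIsometry.toEquivHom σ,
    LinearIsometryEquiv.continuous_iff_apply.2 fun y => ?_, fun φ x => ?_⟩
  · exact e.continuous.comp (Y.continuous_act (e.symm y))
  · change e (Y.act φ (e.symm (e (j x)))) = e (j (φ x))
    rw [e.symm_apply_apply, hj]; rfl

theorem LinearIsometryEquiv.isEmbedding_of_equivariant (ι : E →ₗᵢ[ℝ] G)
    (Θ : (E ≃ₗᵢ[ℝ] E) →* (G ≃ₗᵢ[ℝ] G)) (hΘ : Continuous Θ) (h : ∀ φ x, Θ φ (ι x) = ι (φ x)) :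
    IsEmbedding Θ := by
  refine IsEmbedding.mk (isInducing_iff_nhds.2 fun φ =>
    le_antisymm (hΘ.tendsto φ).le_comap ?_) fun φ ψ hφψ => ?_
  · rw [← Filter.tendsto_id', LinearIsometryEquiv.tendsto_iff_apply]
    intro x
    rw [ι.isometry.isUniformInducing.isInducing.nhds_eq_comap, Filter.tendsto_comap_iff]
    have h1 := ((LinearIsometryEquiv.continuous_eval_const (ι x)).tendsto (Θ φ)).comp
      (Filter.tendsto_comap (f := Θ) (x := 𝓝 (Θ φ)))
    simp only [Function.comp_def, h] at h1
    exact h1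
  · ext x
    exact ι.injective (by rw [← h, ← h, hφψ])

theorem IsometryEquiv.continuous_iff_apply {T : Type*} [TopologicalSpace T] {X : Type u}
    [MetricSpace X] {f : T → (X ≃ᵢ X)} : Continuous f ↔ ∀ x, Continuous fun t => f t x :=
  continuous_induced_rng.trans continuous_pi_iff

theorem IsometryEquiv.toRealLinearIsometryEquiv_mul (φ ψ : E ≃ᵢ E) :
    (φ * ψ).toRealLinearIsometryEquiv =
      φ.toRealLinearIsometryEquiv * ψ.toRealLinearIsometryEquiv := by
  ext x
  have h : ∀ (φ : E ≃ᵢ E) x, φ.toRealLinearIsometryEquiv x = φ x - φ 0 := fun φ x =>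
    φ.toRealLinearIsometryEquiv_apply x
  rw [LinearIsometryEquiv.coe_mul, Function.comp_apply, h ψ, map_sub, h, h, h, IsometryEquiv.mul_apply,
    IsometryEquiv.mul_apply, sub_sub_sub_cancel_right]

/-- By the Mazur–Ulam theorem an isometry is a linear isometry followed by a translation, so that
extending linear isometries is enough. -/
theorem LinearIsometry.isGEmbedding_of_equivariant (ι : E →ₗᵢ[ℝ] G)
    (Θ : (E ≃ₗᵢ[ℝ] E) →* (G ≃ₗᵢ[ℝ] G)) (hΘ : Continuous Θ) (h : ∀ φ x, Θ φ (ι x) = ι (φ x)) :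
    IsGEmbedding ι := by
  have hL : ∀ (φ : E ≃ᵢ E) x, φ.toRealLinearIsometryEquiv x = φ x - φ 0 := fun φ x =>
    φ.toRealLinearIsometryEquiv_apply x
  -- the linear part is extended by `Θ`, the translation part by a translation of `G`
  let T : (E ≃ᵢ E) → (G ≃ᵢ G) := fun φ =>
    (Θ φ.toRealLinearIsometryEquiv).toIsometryEquiv.trans (IsometryEquiv.addRight (ι (φ 0)))
  have hT : ∀ φ y, T φ y = Θ φ.toRealLinearIsometryEquiv y + ι (φ 0) := fun φ y => rfl
  have hmul : ∀ φ ψ, T (φ * ψ) = T φ * T ψ := fun φ ψ => by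
    ext y
    rw [IsometryEquiv.mul_apply, hT, hT, hT, IsometryEquiv.toRealLinearIsometryEquiv_mul, map_mul,
      LinearIsometryEquiv.coe_mul, Function.comp_apply, map_add, h, hL, add_assoc, ← map_add, sub_add_cancel]
    rfl
  refine ⟨ι.isometry, MonoidHom.mk' T hmul, ?_, fun φ x => ?_⟩
  · refine IsometryEquiv.continuous_iff_apply.2 fun y => ?_
    have h0 : ∀ x, Continuous fun φ : E ≃ᵢ E => φ x :=
      IsometryEquiv.continuous_iff_apply.1 continuous_id
    have h1 : Continuous fun φ : E ≃ᵢ E => φ.toRealLinearIsometryEquiv :=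
      LinearIsometryEquiv.continuous_iff_apply.2 fun x => by
        simp only [hL]
        exact (h0 x).sub (h0 0)
    exact ((LinearIsometryEquiv.continuous_eval_const y).comp (hΘ.comp h1)).add
      (ι.continuous.comp (h0 0))
  · change T φ (ι x) = _
    rw [hT, h, hL, ← map_add, sub_add_cancel]

end Equivariant

/-! ### Polish groups as groups of linear isometries -/

section PolishGroup

variable {H : Type w} [Group H] [TopologicalSpace H] [IsTopologicalGroup H]

/-- The Birkhoff–Kakutani theorem, for length functions: the topology of a first countable
topological group is given by a bounded length function. It is obtained from a metric of the left
uniformity, on taking the supremum over all left translations. -/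
theorem IsTopologicalGroup.exists_length [FirstCountableTopology H] :
    ∃ L : H → ℝ, L 1 = 0 ∧ (∀ x, 0 ≤ L x) ∧ (∀ x, L x ≤ 1) ∧ (∀ x, L x⁻¹ = L x) ∧
      (∀ x y, L (x * y) ≤ L x + L y) ∧ Filter.comap L (𝓝 0) = 𝓝 1 := by
  let : UniformSpace H := IsTopologicalGroup.leftUniformSpace H
  have hu : uniformity H = Filter.comap (fun p : H × H => p.1⁻¹ * p.2) (𝓝 1) := rfl
  have : (uniformity H).IsCountablyGenerated := by rw [hu]; infer_instance
  let : PseudoMetricSpace H := UniformSpace.pseudoMetricSpace H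
  have hu' : uniformity H = Filter.comap (fun p : H × H => p.1⁻¹ * p.2) (𝓝 1) := rfl
  let m : H → H → ℝ := fun x g => min (dist g (g * x)) 1
  have hm0 : ∀ x g, 0 ≤ m x g := fun x g => le_min dist_nonneg zero_le_one
  have hm1 : ∀ x g, m x g ≤ 1 := fun x g => min_le_right _ _
  have hbdd : ∀ x, BddAbove (Set.range (m x)) := fun x =>
    ⟨1, by rintro _ ⟨g, rfl⟩; exact hm1 x g⟩
  let L : H → ℝ := fun x => ⨆ g, m x g
  have hmL : ∀ x g, m x g ≤ L x := fun x g => le_ciSup (hbdd x) g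
  have hinv : ∀ x, L x⁻¹ ≤ L x := fun x => ciSup_le fun g => by
    refine le_trans (le_of_eq ?_) (hmL x (g * x⁻¹))
    simp only [m, inv_mul_cancel_right, dist_comm]
  refine ⟨L, ?_, fun x => (hm0 x 1).trans (hmL x 1), fun x => ciSup_le (hm1 x), fun x =>
    le_antisymm (hinv x) (by simpa using hinv x⁻¹), fun x y => ciSup_le fun g => ?_, ?_⟩
  · simp [L, m]
  · have h1 := dist_triangle g (g * x) (g * (x * y))
    have h2 := hmL x g
    have h3 := hmL y (g * x)
    have h4 : 0 ≤ dist g (g * x) := dist_nonneg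
    have h5 : 0 ≤ dist (g * x) (g * (x * y)) := dist_nonneg
    have h6 : m (x * y) g ≤ m x g + m y (g * x) := by
      simp only [m, ← mul_assoc] at h1 h4 h5 ⊢
      rcases min_cases (dist g (g * x)) 1 with h | h <;>
      rcases min_cases (dist (g * x) (g * x * y)) 1 with h' | h' <;>
      rcases min_cases (dist g (g * x * y)) 1 with h'' | h'' <;> linarith
    linarith
  · refine le_antisymm ?_ ?_
    · intro U hU
      have h1 : (fun p : H × H => p.1⁻¹ * p.2) ⁻¹' U ∈ uniformity H := by
        rw [hu']; exact Filter.preimage_mem_comap hU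
      obtain ⟨ε, hε, h2⟩ := Metric.mem_uniformity_dist.1 h1
      refine ⟨Metric.ball 0 (min ε 1), Metric.ball_mem_nhds _ (by positivity), fun x hx => ?_⟩
      have h3 : L x < min ε 1 := (le_abs_self _).trans_lt (by simpa using hx)
      have h4 : min (dist 1 (1 * x)) 1 < min ε 1 := (hmL x 1).trans_lt h3
      have h5 : dist 1 x < ε := by
        rw [one_mul] at h4
        rcases min_lt_iff.1 h4 with h | h
        · exact h.trans_le (min_le_left _ _)
        · exact absurd (min_le_right ε 1) h.not_ge
      simpa using h2 h5
    · rw [← Filter.tendsto_iff_comap, Metric.tendsto_nhds]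
      intro ε hε
      have h1 : {p : H × H | dist p.1 p.2 < ε / 2} ∈ uniformity H :=
        Metric.dist_mem_uniformity (by positivity)
      rw [hu'] at h1
      obtain ⟨U, hU, h2⟩ := h1
      filter_upwards [hU] with x hx
      have h3 : L x ≤ ε / 2 := ciSup_le fun g => (min_le_left _ _).trans
        (le_of_lt (h2 (show (g, g * x) ∈ _ by simpa using hx)))
      have h4 : 0 ≤ L x := (hm0 x 1).trans (hmL x 1)
      rw [Real.dist_eq, sub_zero, abs_of_nonneg h4]
      linarith

open BoundedContinuousFunction in
/-- Every Polish group is a topological subgroup of the linear isometry group of a separable normed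
space. The space is spanned by the translates of a length function in the space of bounded
continuous functions on the group. -/
theorem exists_isEmbedding_linearIsometryEquiv [PolishSpace H] :
    ∃ (E : Type w) (_ : NormedAddCommGroup E) (_ : NormedSpace ℝ E)
      (_ : TopologicalSpace.SeparableSpace E) (f : H →* (E ≃ₗᵢ[ℝ] E)), IsEmbedding f := by
  obtain ⟨L, hL1, hL0, hLle, hLinv, hLmul, hLnhds⟩ := IsTopologicalGroup.exists_length (H := H)
  have hLtend : Filter.Tendsto L (𝓝 1) (𝓝 0) := Filter.tendsto_iff_comap.2 hLnhds.ge
  have hleft : ∀ a x, |L (a * x) - L x| ≤ L a := fun a x => by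
    have h1 := hLmul a x
    have h2 := hLmul a⁻¹ (a * x)
    rw [inv_mul_cancel_left, hLinv] at h2
    rw [abs_le]; constructor <;> linarith
  have hright : ∀ a x, |L (x * a) - L x| ≤ L a := fun a x => by
    have h1 := hleft a⁻¹ x⁻¹
    rwa [← mul_inv_rev, hLinv, hLinv, hLinv] at h1
  have hLc : Continuous L := continuous_iff_continuousAt.2 fun x => by
    rw [ContinuousAt, tendsto_iff_dist_tendsto_zero]
    have h1 : Filter.Tendsto (fun y => L (x⁻¹ * y)) (𝓝 x) (𝓝 0) := by
      refine hLtend.comp ?_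
      have : Continuous fun y : H => x⁻¹ * y := by fun_prop
      simpa using this.tendsto x
    refine squeeze_zero (fun _ => dist_nonneg) (fun y => ?_) h1
    simpa [Real.dist_eq] using hright (x⁻¹ * y) x
  let f₀ : H →ᵇ ℝ := BoundedContinuousFunction.ofNormedAddCommGroup L hLc 1 fun x => by
    rw [Real.norm_eq_abs, abs_of_nonneg (hL0 x)]; exact hLle x
  have hf₀ : ∀ x, f₀ x = L x := fun x => rfl
  -- the left regular representation
  let t : H → C(H, H) := fun γ => ⟨fun x => γ⁻¹ * x, by fun_prop⟩
  let A : H →* ((H →ᵇ ℝ) →ₗᵢ[ℝ] (H →ᵇ ℝ)) :=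
    { toFun := fun γ =>
        { toFun := fun f => f.compContinuous (t γ)
          map_add' := fun f g => rfl
          map_smul' := fun c f => rfl
          norm_map' := fun f => by
            refine le_antisymm ((norm_le (norm_nonneg f)).2 fun x => f.norm_coe_le_norm _)
              ((norm_le (norm_nonneg _)).2 fun x => ?_)
            have h := (f.compContinuous (t γ)).norm_coe_le_norm (γ * x)
            rwa [compContinuous_apply, show t γ (γ * x) = x from inv_mul_cancel_left γ x] at h }
      map_one' := by
        ext f x
        exact congrArg f (show (1 : H)⁻¹ * x = x by simp)
      map_mul' := fun γ γ' => by
        ext f x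
        exact congrArg f (show (γ * γ')⁻¹ * x = γ'⁻¹ * (γ⁻¹ * x) by group) }
  have hA : ∀ γ f x, A γ f x = f (γ⁻¹ * x) := fun γ f x => rfl
  have hAmul : ∀ γ γ' f, A (γ * γ') f = A γ (A γ' f) := fun γ γ' f => by rw [map_mul]; rfl
  have hf₀c : Continuous fun γ => A γ f₀ := continuous_iff_continuousAt.2 fun γ => by
    rw [ContinuousAt, tendsto_iff_dist_tendsto_zero]
    have h1 : Filter.Tendsto (fun γ' => L (γ'⁻¹ * γ)) (𝓝 γ) (𝓝 0) := by
      refine hLtend.comp ?_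
      have : Continuous fun y : H => y⁻¹ * γ := by fun_prop
      simpa using this.tendsto γ
    refine squeeze_zero (fun _ => dist_nonneg) (fun γ' => ?_) h1
    refine (dist_le (hL0 _)).2 fun x => ?_
    rw [hA, hA, hf₀, hf₀, Real.dist_eq]
    simpa [mul_assoc] using hleft (γ'⁻¹ * γ) (γ⁻¹ * x)
  let S : Submodule ℝ (H →ᵇ ℝ) := Submodule.span ℝ (Set.range fun γ => A γ f₀)
  have hAS : ∀ γ, ∀ f ∈ S, A γ f ∈ S := fun γ f hf => by
    induction hf using Submodule.span_induction with
    | mem f hf =>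
      obtain ⟨δ, rfl⟩ := hf
      exact Submodule.subset_span ⟨γ * δ, hAmul γ δ f₀⟩
    | zero => rw [map_zero]; exact S.zero_mem
    | add f g _ _ hf hg => rw [map_add]; exact S.add_mem hf hg
    | smul c f _ hf => rw [map_smul]; exact S.smul_mem c hf
  have hAc : ∀ f ∈ S, Continuous fun γ => A γ f := fun f hf => by
    induction hf using Submodule.span_induction with
    | mem f hf =>
      obtain ⟨δ, rfl⟩ := hf
      simp only [← hAmul]
      exact hf₀c.comp (continuous_mul_const δ)
    | zero => simp only [map_zero]; exact continuous_const
    | add f g _ _ hf hg => simp only [map_add]; exact hf.add hg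
    | smul c f _ hf => simp only [map_smul]; exact hf.const_smul c
  have hf₀S : f₀ ∈ S := Submodule.subset_span ⟨1, congrArg (· f₀) (map_one A)⟩
  -- the subspace is replaced by an abstract normed space with an isometric embedding
  obtain ⟨E, _, _, i, hi, hsep⟩ : ∃ (E : Type w) (_ : NormedAddCommGroup E) (_ : NormedSpace ℝ E)
      (i : E →ₗᵢ[ℝ] (H →ᵇ ℝ)), (∀ f, f ∈ S ↔ ∃ y, i y = f) ∧ TopologicalSpace.SeparableSpace E :=
    ⟨S, inferInstance, inferInstance, S.subtypeₗᵢ, fun f => by simp,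
      (TopologicalSpace.isSeparable_range hf₀c).span.separableSpace⟩
  obtain ⟨T, hT⟩ := LinearIsometry.exists_restrict_action A i fun γ x =>
    (hi _).1 (hAS γ _ ((hi _).2 ⟨x, rfl⟩))
  have hTc : Continuous T := LinearIsometryEquiv.continuous_iff_apply.2 fun x => by
    rw [i.isometry.isUniformInducing.isInducing.continuous_iff]
    simp only [Function.comp_def, hT]
    exact hAc _ ((hi _).2 ⟨x, rfl⟩)
  obtain ⟨s₀, hs₀⟩ := (hi _).1 hf₀S
  -- evaluating `T γ' s₀ - T γ s₀`, as a function on the group, at `γ` recovers `L (γ'⁻¹ * γ)`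
  have hTi : IsInducing T := isInducing_iff_nhds.2 fun γ => by
    refine le_antisymm (hTc.tendsto γ).le_comap ?_
    have h1 : Filter.Tendsto (fun γ' => T γ' s₀) (Filter.comap T (𝓝 (T γ))) (𝓝 (T γ s₀)) :=
      ((LinearIsometryEquiv.continuous_eval_const s₀).tendsto (T γ)).comp Filter.tendsto_comap
    have h2 : Filter.Tendsto (fun γ' => L (γ'⁻¹ * γ)) (Filter.comap T (𝓝 (T γ))) (𝓝 0) := by
      refine squeeze_zero (fun _ => hL0 _) (fun γ' => ?_) (tendsto_iff_dist_tendsto_zero.1 h1)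
      have h3 := dist_coe_le_dist (f := A γ' f₀) (g := A γ f₀) γ
      rw [hA, hA, hf₀, hf₀, inv_mul_cancel, hL1, Real.dist_eq, sub_zero] at h3
      rw [← i.dist_map, hT, hT, hs₀]
      exact (le_abs_self _).trans h3
    have h4 : Filter.Tendsto (fun γ' => γ'⁻¹ * γ) (Filter.comap T (𝓝 (T γ))) (𝓝 1) := by
      rw [← hLnhds]
      exact Filter.tendsto_comap_iff.2 h2
    have h5 : Filter.Tendsto (fun γ' => γ * (γ'⁻¹ * γ)⁻¹) (Filter.comap T (𝓝 (T γ)))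
        (𝓝 (γ * 1⁻¹)) := h4.inv.const_mul γ
    simpa [Filter.Tendsto] using h5
  exact ⟨E, inferInstance, inferInstance, hsep, T, hTi, hTi.injective⟩

end PolishGroup

theorem mainTheorem1 :
    (∃ (G : Type) (_ : NormedAddCommGroup G) (_ : NormedSpace ℝ G), IsGurarij G) ∧
    ∀ (G : Type u) [NormedAddCommGroup G] [NormedSpace ℝ G], IsGurarij G →
      IsUniversalPolishGroup.{u, w} (G ≃ₗᵢ[ℝ] G) ∧
      ∀ (E : Type v) [NormedAddCommGroup E] [NormedSpace ℝ E] [TopologicalSpace.SeparableSpace E],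
        ∃ ι : E →ₗᵢ[ℝ] G, IsGEmbedding ι := by
  refine ⟨?_, fun G _ _ hG => ⟨⟨inferInstance, ?_, fun H _ _ _ _ => ?_⟩, fun E _ _ _ => ?_⟩⟩
  · let X : ActedSpace.{0, 0} Unit :=
      { carrier := ℝ
        act := 1
        continuous_act := fun x => continuous_const }
    obtain ⟨Y, -, hY, -⟩ := X.exists_gurarij
    exact ⟨Y.carrier, inferInstance, inferInstance, hY⟩
  · have := hG.complete
    have := hG.separable
    exact LinearIsometryEquiv.polishSpace G
  · obtain ⟨E, _, _, _, f, hf⟩ := exists_isEmbedding_linearIsometryEquiv (H := H)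
    obtain ⟨ι, Θ, hΘ, h⟩ := hG.exists_equivariant_embedding (E := E)
    exact ⟨Θ.comp f, (LinearIsometryEquiv.isEmbedding_of_equivariant ι Θ hΘ h).comp hf⟩
  · obtain ⟨ι, Θ, hΘ, h⟩ := hG.exists_equivariant_embedding (E := E)
    exact ⟨ι, ι.isGEmbedding_of_equivariant Θ hΘ h⟩
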